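/- All systems are $\mathbb Z$-actions $(X,\sigma)$ generated by a homeomorphism $\sigma$ of a compact Hausdorff space $X$. Let $X_{TM}$ and $X_{RS}$, with the left shift $\sigma$, be the two-sided shifts of the Thue–Morse substitution $a\mapsto ab,\ b\mapsto ba$ and of the Rudin–Shapiro substitution $a\mapsto ac,\ b\mapsto dc,\ c\mapsto ab,\ d\mapsto db$ (all bi-infinite sequences every finite subword of which occurs in some $\theta^k(\text{letter})$). For such a system, the Ellis semigroup $E(X)$ is the closure of $\{\sigma^n:n\in\mathbb Z\}$ in $X^X$ for pointwise convergence, a monoid under composition; $\mathcal M(X)$ is its kernel, i.e. its smallest two-sided ideal. Let $\pi:X\to X_{eq}$ be a maximal equicontinuous factor. A point $\xi\in X_{eq}$ is singular if $\pi^{-1}(\xi)$ contains two distinct proximal points. For singular $\xi$, $\mathcal M^{fib}_\xi(X)$ is the semigroup of self-maps of $\pi^{-1}(\xi)$ obtained by restricting to $\pi^{-1}(\xi)$ those elements of $\mathcal M(X)$ that preserve all $\pi$-fibres; when $\xi$ is taken as the neutral element $0$ of $X_{eq}$ it is denoted $\mathcal M^{fib}_0(X)$. An algebraic isomorphism $E(X)\to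 E(X')$ is a bijection $\Phi$ with $\Phi(fg)=\Phi(f)\Phi(g)$, $\Phi(\mathrm{id})=\mathrm{id}$ and $\Phi(\sigma^n f)=\sigma'^n\Phi(f)$ for all $n\in\mathbb Z$. Let $\mathcal M_2$ be the $8$-element matrix semigroup $I\times S_2\times\Lambda$, $|I|=|\Lambda|=2$, with product $(i,g,\lambda)(j,h,\mu)=(i,g\,a_{\lambda j}h,\mu)$ and sandwich matrix $(a_{\lambda j})=\begin{pmatrix}e&e\\ e&\tau\end{pmatrix}$, where $S_2=\{e,\tau\}$. Then: 1. For each of $X=X_{TM}$ and $X=X_{RS}$, and each maximal equicontinuous factor $\pi:X\to X_{eq}$: the set of fixed points of $\theta^2$ in $X$ ($\theta$ being the defining substitution) is the fibre of a singular point, and $\mathcal M^{fib}_\xi(X)\cong\mathcal M_2$ for every singular $\xi\in X_{eq}$; in particular $\mathcal M^{fib}_0(X)\cong\mathcal M_2$. 2. Both shifts have maximal equicontinuous factors, and these are conjugate to each other. 3. There is an algebraic isomorphism $E(X_{TM})\to E(X_{RS})$. 4. The shifts $X_{TM}$ and $X_{RS}$ are not conjugate, and no algebraic isomorphism $E(X_{TM})\to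 E(X_{RS})$ is continuous. -/

import Mathlib

open scoped Topology Uniformity

/-! ### Dynamical systems given by one homeomorphism (actions of the integers) -/

section Dynamics

variable {X Y Z : Type}

/-- A factor map between two systems: a continuous equivariant surjection. -/
structure IsFactorMap [TopologicalSpace X] [TopologicalSpace Y]
    (σ : X ≃ₜ X) (δ : Y ≃ₜ Y) (f : X → Y) : Prop where
  continuous : Continuous f
  surjective : Function.Surjective f
  equivariant : ∀ x, f (σ x) = δ (f x)

/-- Two systems are conjugate if there is an equivariant homeomorphism between them. -/
def AreConjugate [TopologicalSpace X] [TopologicalSpace Y]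
    (σ : X ≃ₜ X) (δ : Y ≃ₜ Y) : Prop :=
  ∃ h : X ≃ₜ Y, ∀ x, h (σ x) = δ (h x)

/-- A system is equicontinuous if the family of all integer powers of the homeomorphism is. -/
def IsEquicontinuousSystem [UniformSpace Y] (δ : Y ≃ₜ Y) : Prop :=
  Equicontinuous (fun n : ℤ => (⇑(δ ^ n) : Y → Y))

/-- `π` is a maximal equicontinuous factor: an equicontinuous factor through which every other
(compact Hausdorff) equicontinuous factor factors. A compact Hausdorff space carries exactly one
uniformity inducing its topology, so `[UniformSpace Z] [CompactSpace Z] [T2Space Z]` is just a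
compact Hausdorff space. -/
structure IsMaximalEquicontinuousFactor [TopologicalSpace X] [UniformSpace Y]
    (σ : X ≃ₜ X) (δ : Y ≃ₜ Y) (π : X → Y) : Prop where
  factor : IsFactorMap σ δ π
  equicontinuous : IsEquicontinuousSystem δ
  maximal : ∀ (Z : Type) [UniformSpace Z] [CompactSpace Z] [T2Space Z] (ζ : Z ≃ₜ Z) (ρ : X → Z),
    IsFactorMap σ ζ ρ → IsEquicontinuousSystem ζ → ∃ f : Y → Z, IsFactorMap δ ζ f ∧ ρ = f ∘ π

/-- Two points of a compact Hausdorff system are proximal if their orbits come simultaneously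
into every entourage; on a compact Hausdorff space the entourages are the neighbourhoods of the
diagonal. -/
def IsProximalPair [TopologicalSpace X] (σ : X ≃ₜ X) (x y : X) : Prop :=
  ∀ U ∈ 𝓝ˢ (Set.diagonal X), ∃ n : ℤ, ((σ ^ n) x, (σ ^ n) y) ∈ U

/-- A point of the factor is singular if its fibre contains two distinct proximal points. -/
def IsSingularPoint [TopologicalSpace X] (σ : X ≃ₜ X) (π : X → Y) (ξ : Y) : Prop :=
  ∃ x y : X, π x = ξ ∧ π y = ξ ∧ x ≠ y ∧ IsProximalPair σ x y

/-! ### The Ellis semigroup -/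

/-- The Ellis semigroup, as a set of self-maps: the closure of the powers of `σ` for the topology
of pointwise convergence. -/
def ellisSet [TopologicalSpace X] (σ : X ≃ₜ X) : Set (X → X) :=
  closure (Set.range fun n : ℤ => (⇑(σ ^ n) : X → X))

/-- The Ellis semigroup, with the topology of pointwise convergence. -/
abbrev EllisSemigroup [TopologicalSpace X] (σ : X ≃ₜ X) : Type := ↥(ellisSet σ)

theorem zpow_mem_ellisSet [TopologicalSpace X] (σ : X ≃ₜ X) (n : ℤ) :
    (⇑(σ ^ n) : X → X) ∈ ellisSet σ :=
  subset_closure ⟨n, rfl⟩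

theorem comp_mem_ellisSet [TopologicalSpace X] (σ : X ≃ₜ X) {f g : X → X}
    (hf : f ∈ ellisSet σ) (hg : g ∈ ellisSet σ) : f ∘ g ∈ ellisSet σ := by
  have h1 : ∀ n : ℤ, (⇑(σ ^ n) : X → X) ∘ g ∈ ellisSet σ := by
    intro n
    have hc : Continuous fun k : X → X => (⇑(σ ^ n) : X → X) ∘ k :=
      continuous_pi fun x => (σ ^ n).continuous.comp (continuous_apply x)
    refine map_mem_closure hc hg ?_
    rintro _ ⟨m, rfl⟩
    exact ⟨n + m, by simp only [zpow_add]; rfl⟩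
  have hc : Continuous fun k : X → X => k ∘ g :=
    continuous_pi fun x => continuous_apply (g x)
  have h2 : f ∘ g ∈ closure (ellisSet σ) := by
    refine map_mem_closure (f := fun k : X → X => k ∘ g) hc hf ?_
    rintro _ ⟨n, rfl⟩
    exact h1 n
  rwa [ellisSet, closure_closure] at h2

/-- Multiplication in the Ellis semigroup is composition. -/
instance ellisMonoid [TopologicalSpace X] (σ : X ≃ₜ X) : Monoid (EllisSemigroup σ) where
  mul f g := ⟨f.1 ∘ g.1, comp_mem_ellisSet σ f.2 g.2⟩
  one := ⟨id, zpow_mem_ellisSet σ 0⟩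
  mul_assoc _ _ _ := rfl
  one_mul _ := rfl
  mul_one _ := rfl

theorem ellis_mul_apply [TopologicalSpace X] (σ : X ≃ₜ X) (f g : EllisSemigroup σ) (x : X) :
    (f * g).1 x = f.1 (g.1 x) := rfl

/-- The action of the integer `n` on the Ellis semigroup: `f ↦ σⁿ ∘ f`. -/
def ellisShift [TopologicalSpace X] (σ : X ≃ₜ X) (n : ℤ) (f : EllisSemigroup σ) :
    EllisSemigroup σ :=
  ⟨⇑(σ ^ n) ∘ f.1, comp_mem_ellisSet σ (zpow_mem_ellisSet σ n) f.2⟩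

/-- An algebraic morphism of Ellis semigroups: an equivariant monoid morphism. -/
structure IsAlgebraicMorphism [TopologicalSpace X] [TopologicalSpace Y]
    {σ : X ≃ₜ X} {δ : Y ≃ₜ Y} (Φ : EllisSemigroup σ → EllisSemigroup δ) : Prop where
  map_mul : ∀ f g, Φ (f * g) = Φ f * Φ g
  map_one : Φ 1 = 1
  map_shift : ∀ (n : ℤ) (f), Φ (ellisShift σ n f) = ellisShift δ n (Φ f)

/-- A two-sided (non-empty) ideal of a semigroup. -/
structure IsTwoSidedIdeal {S : Type} [Mul S] (I : Set S) : Prop where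
  nonempty : I.Nonempty
  mul_mem_left : ∀ s, ∀ x ∈ I, s * x ∈ I
  mul_mem_right : ∀ s, ∀ x ∈ I, x * s ∈ I

/-- The kernel of a semigroup: the intersection of all its two-sided ideals. (In an Ellis
semigroup of a compact Hausdorff system this is the smallest two-sided ideal.) -/
def semigroupKernel (S : Type) [Mul S] : Set S := ⋂₀ {I | IsTwoSidedIdeal I}

theorem mul_mem_semigroupKernel {S : Type} [Mul S] {a b : S} (hb : b ∈ semigroupKernel S) :
    a * b ∈ semigroupKernel S :=
  fun I hI => hI.mul_mem_left a b (hb I hI)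

/-- The elements of the Ellis semigroup which preserve all fibres of `π`. -/
def fibrePreserving [TopologicalSpace X] (σ : X ≃ₜ X) (π : X → Y) : Set (EllisSemigroup σ) :=
  {f | ∀ x, π (f.1 x) = π x}

/-- The elements of the kernel of the Ellis semigroup which preserve all fibres of `π`, restricted
to the fibre over `ξ`; a semigroup of self-maps of that fibre under composition. -/
def kernelFibreSemigroup [TopologicalSpace X] (σ : X ≃ₜ X) (π : X → Y) (ξ : Y) :
    Subsemigroup (Function.End ↥(π ⁻¹' {ξ})) where
  carrier := {φ | ∃ f ∈ semigroupKernel (EllisSemigroup σ) ∩ fibrePreserving σ π,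
    ∀ x : ↥(π ⁻¹' {ξ}), (φ x : X) = f.1 x}
  mul_mem' := by
    rintro φ ψ ⟨f, ⟨_, hf⟩, hφ⟩ ⟨g, ⟨hgk, hg⟩, hψ⟩
    refine ⟨f * g, ⟨mul_mem_semigroupKernel hgk, fun x => ?_⟩, fun x => ?_⟩
    · rw [ellis_mul_apply, hf, hg]
    · rw [ellis_mul_apply, ← hψ x]
      exact hφ (ψ x)

end Dynamics

/-! ### Matrix semigroups -/

/-- The matrix semigroup `M[G; I, Λ; A]` with underlying set `I × G × Λ` and sandwich
matrix `A`. -/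
@[ext] structure MatrixSemigroup {I G Λ : Type} (A : Λ → I → G) : Type where
  row : I
  val : G
  col : Λ

instance matrixSemigroupSemigroup {I G Λ : Type} [Group G] (A : Λ → I → G) :
    Semigroup (MatrixSemigroup A) where
  mul x y := ⟨x.row, x.val * A x.col y.row * y.val, y.col⟩
  mul_assoc x y z := by
    change MatrixSemigroup.mk x.row
        ((x.val * A x.col y.row * y.val) * A y.col z.row * z.val) z.col =
      MatrixSemigroup.mk x.row
        (x.val * A x.col y.row * (y.val * A y.col z.row * z.val)) z.col
    simp only [mul_assoc]

/-- The semigroup `𝓜₂`: two rows, two columns, structure group `S₂`, and sandwich matrix with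
entries `e, e` (first row) and `e, τ` (second row), where `τ` is the transposition. -/
abbrev MatrixSemigroupM2 : Type :=
  MatrixSemigroup (I := Fin 2) (G := Equiv.Perm (Fin 2)) (Λ := Fin 2)
    (![![1, 1], ![1, Equiv.swap 0 1]] : Fin 2 → Fin 2 → Equiv.Perm (Fin 2))

/-! ### Substitution shifts -/

section Substitution

variable {A : Type}

/-- The image of a finite word under a substitution, by concatenation. -/
def substWord (θ : A → List A) (w : List A) : List A := w.flatMap θ

/-- A word is allowed if it occurs in `θᵏ(a)` for some letter `a` and some `k`. -/
def IsAllowedWord (θ : A → List A) (w : List A) : Prop :=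
  ∃ (a : A) (k : ℕ), w <:+: (substWord θ)^[k] [a]

/-- The bi-infinite sequences all of whose finite subwords are allowed. -/
def substShiftSet (θ : A → List A) : Set (ℤ → A) :=
  {x | ∀ (i : ℤ) (n : ℕ), IsAllowedWord θ (List.ofFn fun j : Fin n => x (i + (j : ℕ)))}

/-- The substitution shift space, with the subspace topology of the product topology. -/
abbrev SubstShift (θ : A → List A) : Type := ↥(substShiftSet θ)

theorem translate_mem_substShiftSet {θ : A → List A} {x : ℤ → A} (hx : x ∈ substShiftSet θ)
    (c : ℤ) : (fun n => x (n + c)) ∈ substShiftSet θ := by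
  intro i n
  have h := hx (i + c) n
  simpa only [add_right_comm] using h

/-- The left shift on the substitution shift space. -/
def substShiftMap [TopologicalSpace A] (θ : A → List A) : SubstShift θ ≃ₜ SubstShift θ where
  toFun x := ⟨fun n => x.1 (n + 1), translate_mem_substShiftSet x.2 1⟩
  invFun x := ⟨fun n => x.1 (n + -1), translate_mem_substShiftSet x.2 (-1)⟩
  left_inv x := by ext n; simp
  right_inv x := by ext n; simp
  continuous_toFun := by
    refine Continuous.subtype_mk (continuous_pi fun n => ?_) _
    exact (continuous_apply (n + 1)).comp continuous_subtype_val
  continuous_invFun := by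
    refine Continuous.subtype_mk (continuous_pi fun n => ?_) _
    exact (continuous_apply (n + -1)).comp continuous_subtype_val

/-- The composition `θ²` of a substitution with itself. -/
def substSquare (θ : A → List A) : A → List A := fun a => substWord θ (θ a)

/-- `x` is a fixed point of the substitution `θ` of constant length `ℓ`: for every `n`, the block
`x_{ℓn} ⋯ x_{ℓn+ℓ-1}` is the word `θ(x_n)`. -/
def IsSubstFixedPoint (θ : A → List A) (ℓ : ℕ) (x : ℤ → A) : Prop :=
  ∀ n : ℤ, (List.ofFn fun j : Fin ℓ => x ((ℓ : ℤ) * n + (j : ℕ))) = θ (x n)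

end Substitution

/-- The Thue–Morse substitution `a ↦ ab`, `b ↦ ba`, with `a = 0`, `b = 1`. -/
def thueMorse : Fin 2 → List (Fin 2) := ![[0, 1], [1, 0]]

/-- The Rudin–Shapiro substitution `a ↦ ac`, `b ↦ dc`, `c ↦ ab`, `d ↦ db`, with `a = 0`,
`b = 1`, `c = 2`, `d = 3`. -/
def rudinShapiro : Fin 4 → List (Fin 4) := ![[0, 2], [3, 2], [0, 1], [3, 1]]

/-! Both substitutions are cases of one construction. Label the letters by a parity `t` and a sign
`s` in ℤ/2 so that the substitution reads (t, s) ↦ (0, s)(1, s + ψ t) with ψ 1 = 1; Thue–Morse is ψ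
= 1 and Rudin–Shapiro is ψ = id. Desubstituting a point indefinitely gives it an address y in ℤ₂:
the letter at place n has the parity of y + n, and the sign changes by e(y + n) between places n - 1
and n. The increment `e` is locally constant away from 0. At 0 its recursion would read e(0) = e(0)
- 1, so the jump there is free. Hence the fibre of the address map π over a non-integer has two
points, exchanged by flipping all signs, while over an integer the signs on the two sides of the gap
are independent and the fibre has four points.

The engine is independence. Let `β` be a primitive of `e`. A sum of `β` along finitely many distinct
points is never eventually periodic with period a power of two (`IsDigitCocycle.not_evPer`). This
makes addresses unique and, by linear duality over ℤ/2, shows that along finitely many different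
orbits every sign vector is attained by integers tending to a given end of ℤ and to 0 in ℤ₂
(`IsDigitCocycle.frequently_sign`).

A limit of powers σⁿ along a non-principal ultrafilter commutes with the shift and with flipping
signs. It translates addresses by z = lim n, over 0 it reads only the signs on the side d to which n
tends, and it writes the jump i = lim e(n - z). `HasType` records exactly this. Conversely,
independence puts every map with a type in the Ellis semigroup (`IsModel.mem_ellisSet_of_hasType`),
and these maps form the kernel. On a singular fibre those with z = 0 act on pairs of signs as
`MatrixSemigroupM2`. Types are defined without topology, so adding to the signs a primitive of the
difference of the two increments carries one Ellis semigroup onto the other, although this map of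
points need not be continuous.

The topology separates the shifts because e(2ᵗ⁺¹) = t but e(3·2ᵗ⁺¹) = 1 - ψ 0 + t. Along even t the
two limits have the same row for Thue–Morse and different rows for Rudin–Shapiro. Two limits of one
type satisfy g = f h, and multiplicativity then forces equal rows on the other side, which a
continuous morphism would contradict (`IsModel.not_continuous`). A conjugacy would induce a
continuous morphism. -/

section DigitCocycleExtensions

open Filter

/-! ### Two-adic arithmetic -/

section Arithmetic

/-- The parity of a 2-adic integer. -/
noncomputable abbrev bit (w : ℤ_[2]) : ZMod 2 := PadicInt.toZMod w

theorem bit_two_mul (w : ℤ_[2]) : bit (2 * w) = 0 := by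
  rw [two_mul, bit, map_add]
  exact CharTwo.add_self_eq_zero _

theorem bit_two_mul_add_one (w : ℤ_[2]) : bit (2 * w + 1) = 1 := by
  have := bit_two_mul w
  simp only [bit, map_add, map_one] at this ⊢
  rw [this, zero_add]

theorem zmod_two_cases (a : ZMod 2) : a = 0 ∨ a = 1 := by
  revert a; decide

theorem zmod_two_add_self (a : ZMod 2) : a + a = 0 := CharTwo.add_self_eq_zero a

theorem exists_half (w : ℤ_[2]) : ∃ h : ℤ_[2], w = 2 * h ∨ w = 2 * h + 1 := by
  have key : ∀ u : ℤ_[2], bit u = 0 → ∃ h, u = 2 * h := by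
    intro u hu
    have h1 : u ∈ RingHom.ker (PadicInt.toZMod (p := 2)) := hu
    rw [PadicInt.ker_toZMod, PadicInt.maximalIdeal_eq_span_p, Ideal.mem_span_singleton] at h1
    simpa [dvd_iff_exists_eq_mul_right] using h1
  rcases zmod_two_cases (bit w) with h | h
  · obtain ⟨k, hk⟩ := key w h
    exact ⟨k, Or.inl hk⟩
  · obtain ⟨k, hk⟩ := key (w - 1) (by simp [bit] at h ⊢; rw [h, sub_self])
    exact ⟨k, Or.inr (by rw [← hk, sub_add_cancel])⟩

theorem two_mul_ne_two_mul_add_one (a b : ℤ_[2]) : 2 * a ≠ 2 * b + 1 := by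
  intro h
  have := congrArg bit h
  rw [bit_two_mul, bit_two_mul_add_one] at this
  exact zero_ne_one this

theorem two_mul_inj {a b : ℤ_[2]} (h : 2 * a = 2 * b) : a = b :=
  mul_left_cancel₀ two_ne_zero h

/-- The sets `w + 2ᵏ ℤ₂` form a neighbourhood basis. -/
theorem mem_nhds_iff_pow {w : ℤ_[2]} {U : Set ℤ_[2]} :
    U ∈ 𝓝 w ↔ ∃ k : ℕ, ∀ u, (2 : ℤ_[2]) ^ k ∣ u - w → u ∈ U := by
  have hd : ∀ (k : ℕ) (u : ℤ_[2]), (2 : ℤ_[2]) ^ k ∣ u ↔ ‖u‖ ≤ (2 : ℝ) ^ (-k : ℤ) := by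
    intro k u
    have := PadicInt.norm_le_pow_iff_mem_span_pow (p := 2) u k
    rw [Ideal.mem_span_singleton] at this
    simpa using this.symm
  rw [Metric.mem_nhds_iff]
  constructor
  · rintro ⟨ε, hε, h⟩
    obtain ⟨k, hk⟩ := PadicInt.exists_pow_neg_lt 2 hε
    refine ⟨k, fun u hu => h ?_⟩
    rw [hd] at hu
    rw [Metric.mem_ball, dist_eq_norm]
    exact hu.trans_lt (by simpa using hk)
  · rintro ⟨k, h⟩
    refine ⟨(2 : ℝ) ^ (-k : ℤ), by positivity, fun u hu => h u ?_⟩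
    rw [hd]
    rw [Metric.mem_ball, dist_eq_norm] at hu
    exact hu.le

theorem eq_of_forall_pow_dvd {u w : ℤ_[2]} (h : ∀ k : ℕ, (2 : ℤ_[2]) ^ k ∣ u - w) : u = w := by
  by_contra hne
  have : {u}ᶜ ∈ 𝓝 w := isOpen_compl_singleton.mem_nhds (Ne.symm hne)
  obtain ⟨k, hk⟩ := mem_nhds_iff_pow.1 this
  exact hk u (h k) rfl

theorem exists_not_pow_dvd {w : ℤ_[2]} (h : w ≠ 0) : ∃ k : ℕ, ¬ (2 : ℤ_[2]) ^ k ∣ w := by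
  by_contra! hc
  exact h (eq_of_forall_pow_dvd fun k => by simpa using hc k)

/-- The recursion for the increments of the digit cocycle attached to `ψ`. -/
structure IsIncrement (ψ : ZMod 2 → ZMod 2) (e : ℤ_[2] → ZMod 2) : Prop where
  one : ψ 1 = 1
  odd : ∀ w, e (2 * w + 1) = ψ (bit w)
  even : ∀ w, w ≠ 0 → e (2 * w) = e w - ψ (bit w - 1)

/-- Halving a nonzero 2-adic integer ends after as many steps as its valuation, so the recursion can
be run on the valuation. The value produced at 0 is a mere default: no condition bears on it. -/
theorem exists_isIncrement {ψ : ZMod 2 → ZMod 2} (hψ : ψ 1 = 1) :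
    ∃ e : ℤ_[2] → ZMod 2, IsIncrement ψ e := by
  choose half hhalf using exists_half
  have half_even : ∀ w, half (2 * w) = w := by
    intro w
    rcases hhalf (2 * w) with h | h
    · exact (two_mul_inj h).symm
    · exact absurd h (two_mul_ne_two_mul_add_one _ _)
  have half_odd : ∀ w, half (2 * w + 1) = w := by
    intro w
    rcases hhalf (2 * w + 1) with h | h
    · exact absurd h.symm (two_mul_ne_two_mul_add_one _ _)
    · exact (two_mul_inj (add_right_cancel h)).symm
  let E : ℕ → ℤ_[2] → ZMod 2 := fun t => Nat.rec (fun w => ψ (bit (half w)))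
    (fun _ E w => E (half w) - ψ (bit (half w) - 1)) t
  refine ⟨fun w => E w.valuation w, hψ, fun w => ?_, fun w hw => ?_⟩
  · have : (2 * w + 1).valuation = 0 := by
      by_contra hv
      have h0 : 2 * w + 1 ≠ 0 := fun h => two_mul_ne_two_mul_add_one 0 w (by rw [h, mul_zero])
      have h1 := (PadicInt.mem_span_pow_iff_le_valuation (2 * w + 1) h0 1).2
        (Nat.one_le_iff_ne_zero.2 hv)
      rw [Ideal.mem_span_singleton] at h1
      obtain ⟨c, hc⟩ := h1
      exact two_mul_ne_two_mul_add_one c w (by rw [hc]; simp)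
    simp only [this]
    change ψ (bit (half (2 * w + 1))) = _
    rw [half_odd]
  · have : (2 * w).valuation = w.valuation + 1 := by
      have := PadicInt.valuation_p_pow_mul (p := 2) 1 w hw
      simp at this
      omega
    simp only [this]
    change E w.valuation (half (2 * w)) - ψ (bit (half (2 * w)) - 1) = _
    rw [half_even]

variable {ψ : ZMod 2 → ZMod 2} {e : ℤ_[2] → ZMod 2}

/-- For `w` not divisible by 2ᵏ the recursion reaches an odd number in fewer than `k` halvings and
therefore inspects only finitely many binary digits of `w`. -/
theorem IsIncrement.locally_constant (he : IsIncrement ψ e) {w : ℤ_[2]} (hw : w ≠ 0) :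
    ∀ᶠ u in 𝓝 w, e u = e w := by
  have key : ∀ (k : ℕ) (w : ℤ_[2]), ¬ (2 : ℤ_[2]) ^ k ∣ w →
      ∃ m : ℕ, ∀ u, (2 : ℤ_[2]) ^ m ∣ u - w → e u = e w := by
    intro k
    induction k with
    | zero => intro w h; exact absurd (by simp) h
    | succ k ih =>
      intro w h
      obtain ⟨w', rfl | rfl⟩ := exists_half w
      · have h' : ¬ (2 : ℤ_[2]) ^ k ∣ w' := fun hd => h (by
          rw [pow_succ']; exact mul_dvd_mul_left 2 hd)
        obtain ⟨m, hm⟩ := ih w' h'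
        have hb : ∀ u, (2 : ℤ_[2]) ∣ u - w' → bit u = bit w' := by
          rintro u ⟨c, hc⟩
          rw [sub_eq_iff_eq_add.1 hc]
          have := bit_two_mul c
          simp only [bit, map_add] at this ⊢
          rw [this, zero_add]
        refine ⟨m + k + 2, ?_⟩
        rintro u ⟨c, hc⟩
        obtain rfl : u = 2 * (w' + 2 ^ (m + k + 1) * c) := by
          rw [sub_eq_iff_eq_add.1 hc]; ring
        have hw0 : w' ≠ 0 := by rintro rfl; simp at h'
        have hu0 : w' + 2 ^ (m + k + 1) * c ≠ 0 := by
          intro h0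
          refine h' ⟨-(2 ^ (m + 1) * c), ?_⟩
          rw [← sub_eq_zero, ← h0]; ring
        rw [he.even _ hu0, he.even _ hw0, hm _ ⟨2 ^ (k + 1) * c, by ring⟩,
          hb _ ⟨2 ^ (m + k) * c, by ring⟩]
      · refine ⟨2, ?_⟩
        rintro u ⟨c, hc⟩
        obtain rfl : u = 2 * (2 * c + w') + 1 := by rw [sub_eq_iff_eq_add.1 hc]; ring
        rw [he.odd, he.odd]
        have := bit_two_mul c
        simp only [bit, map_add] at this ⊢
        rw [this, zero_add]
  obtain ⟨k, hk⟩ := exists_not_pow_dvd hw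
  obtain ⟨m, hm⟩ := key k w hk
  exact mem_nhds_iff_pow.2 ⟨m, hm⟩

theorem eventually_bit_eq (w : ℤ_[2]) : ∀ᶠ u in 𝓝 w, bit u = bit w := by
  refine mem_nhds_iff_pow.2 ⟨1, ?_⟩
  rintro u ⟨c, hc⟩
  have := bit_two_mul c
  rw [Set.mem_ofPred_eq, sub_eq_iff_eq_add.1 hc]
  simp only [bit, map_add, pow_one] at this ⊢
  rw [this, zero_add]

theorem bit_intCast (n : ℤ) : bit n = n := by simp [bit]

theorem IsIncrement.one_add_four_mul (he : IsIncrement ψ e) (c : ℤ_[2]) :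
    e (1 + 4 * c) = ψ 0 := by
  rw [show 1 + 4 * c = 2 * (2 * c) + 1 by ring, he.odd, bit_two_mul]

theorem IsIncrement.three_add_four_mul (he : IsIncrement ψ e) (c : ℤ_[2]) :
    e (3 + 4 * c) = 1 := by
  rw [show 3 + 4 * c = 2 * (2 * c + 1) + 1 by ring, he.odd, bit_two_mul_add_one, he.one]

theorem odd_ne_zero (c : ℤ_[2]) : 2 * c + 1 ≠ 0 := fun h =>
  two_mul_ne_two_mul_add_one 0 c (by rw [h, mul_zero])

/-- The increments at `2ᵗ⁺¹ u` with `u` odd. -/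
theorem IsIncrement.pow_mul_odd (he : IsIncrement ψ e) (t : ℕ) (c : ℤ_[2]) :
    e (2 ^ (t + 1) * (2 * c + 1)) = e (2 * c + 1) - ψ 0 + t := by
  induction t with
  | zero =>
    rw [zero_add, pow_one, he.even _ (odd_ne_zero c), bit_two_mul_add_one]
    simp
  | succ t ih =>
    have h0 : (2 : ℤ_[2]) ^ (t + 1) * (2 * c + 1) ≠ 0 :=
      mul_ne_zero (pow_ne_zero _ two_ne_zero) (odd_ne_zero c)
    have hb : bit ((2 : ℤ_[2]) ^ (t + 1) * (2 * c + 1)) = 0 := by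
      rw [pow_succ', mul_assoc, bit_two_mul]
    rw [pow_succ', mul_assoc, he.even _ h0, ih, hb, zero_sub,
      show (-1 : ZMod 2) = 1 from rfl, he.one, sub_eq_add_neg _ (1 : ZMod 2),
      show (-1 : ZMod 2) = 1 from rfl]
    push_cast; ring

theorem IsIncrement.pow_mul_one_add (he : IsIncrement ψ e) (t : ℕ) (c : ℤ_[2]) :
    e (2 ^ (t + 1) * (1 + 4 * c)) = t := by
  have := he.pow_mul_odd t (2 * c)
  rw [show 2 * (2 * c) + 1 = 1 + 4 * c by ring, he.one_add_four_mul] at this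
  rw [this]; ring

theorem IsIncrement.pow_mul_three_add (he : IsIncrement ψ e) (t : ℕ) (c : ℤ_[2]) :
    e (2 ^ (t + 1) * (3 + 4 * c)) = 1 - ψ 0 + t := by
  have := he.pow_mul_odd t (2 * c + 1)
  rwa [show 2 * (2 * c + 1) + 1 = 3 + 4 * c by ring, he.three_add_four_mul] at this

/-- A choice of one point on each orbit of the odometer, which is `0` on the orbit of `0`. -/
theorem exists_orbit_representative : ∃ r : ℤ_[2] → ℤ_[2], (∀ y, ∃ n : ℤ, y = r y + n) ∧
    (∀ y, ∀ n : ℤ, r (y + n) = r y) ∧ ∀ y, r y = 0 ∨ ∀ n : ℤ, r y ≠ n := by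
  classical
  let s : Setoid ℤ_[2] :=
    { r := fun x y => ∃ n : ℤ, x = y + n
      iseqv := ⟨fun x => ⟨0, by simp⟩, fun {x y} ⟨n, hn⟩ => ⟨-n, by rw [hn]; push_cast; ring⟩,
        fun {x y z} ⟨n, hn⟩ ⟨m, hm⟩ => ⟨m + n, by rw [hn, hm]; push_cast; ring⟩⟩ }
  have hout : ∀ y : ℤ_[2], ∃ n : ℤ, y = (Quotient.mk s y).out + n := by
    intro w
    obtain ⟨n, hn⟩ := Quotient.exact (Quotient.out_eq (Quotient.mk s w))
    exact ⟨-n, by rw [hn]; push_cast; ring⟩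
  refine ⟨fun y => if ∃ m : ℤ, y = m then 0 else (Quotient.mk s y).out, fun y => ?_, fun y n => ?_,
    fun y => ?_⟩
  · by_cases h : ∃ m : ℤ, y = m
    · simpa only [if_pos h, zero_add] using h
    · simpa only [if_neg h] using hout y
  · have h1 : (∃ m : ℤ, y + n = m) ↔ ∃ m : ℤ, y = m :=
      ⟨fun ⟨m, hm⟩ => ⟨m - n, by rw [Int.cast_sub, ← hm]; ring⟩,
        fun ⟨m, hm⟩ => ⟨m + n, by rw [Int.cast_add, ← hm]⟩⟩
    have h2 : Quotient.mk s (y + n) = Quotient.mk s y := Quotient.sound ⟨n, rfl⟩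
    simp only [h1, h2]
  · by_cases h : ∃ m : ℤ, y = m
    · exact Or.inl (if_pos h)
    · refine Or.inr fun n hn => h ?_
      simp only [if_neg h] at hn
      obtain ⟨m, hm⟩ := hout y
      exact ⟨n + m, by rw [hm, hn]; push_cast; ring⟩

/-- Every function on the 2-adic integers is a coboundary for the translation by `1`. -/
theorem exists_coboundary (g : ℤ_[2] → ZMod 2) : ∃ β : ℤ_[2] → ZMod 2, ∀ w, β w = β (w - 1) + g w := by
  have hz : ∀ f : ℤ → ZMod 2, ∃ b : ℤ → ZMod 2, ∀ n, b n = b (n - 1) + f n := by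
    intro f
    refine ⟨fun n => ∑ i ∈ Finset.Ioc 0 n, f i - ∑ i ∈ Finset.Ioc n 0, f i, fun n => ?_⟩
    rcases le_or_gt n 0 with h | h
    · have : Finset.Ioc (n - 1) 0 = insert n (Finset.Ioc n 0) := by ext i; simp; omega
      simp only [this]
      rw [Finset.sum_insert (by simp), Finset.Ioc_eq_empty_of_le h,
        Finset.Ioc_eq_empty_of_le (a := 0) (b := n - 1) (by omega)]
      simp [add_assoc, zmod_two_add_self]
    · have : Finset.Ioc 0 n = insert n (Finset.Ioc 0 (n - 1)) := by ext i; simp; omega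
      simp only [this]
      rw [Finset.sum_insert (by simp), Finset.Ioc_eq_empty_of_le (a := n) (by omega),
        Finset.Ioc_eq_empty_of_le (a := n - 1) (by omega)]
      simp [add_comm]
  -- Translation by 1 acts freely, so each orbit is a copy of ℤ and the primitive is chosen orbit by
  -- orbit, with no continuity.
  obtain ⟨r, hr, hr', -⟩ := exists_orbit_representative
  choose b hb using fun y : ℤ_[2] => hz fun n => g (y + n)
  choose k hk using hr
  refine ⟨fun w => b (r w) (k w), fun w => ?_⟩
  have hq : r (w - 1) = r w := by simpa [sub_eq_add_neg] using hr' w (-1)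
  have hkk : k (w - 1) = k w - 1 := by
    have h1 := hk (w - 1)
    rw [hq] at h1
    have h3 : ((k (w - 1) : ℤ) : ℤ_[2]) = ((k w - 1 : ℤ) : ℤ_[2]) := by
      push_cast
      linear_combination hk w - h1
    exact_mod_cast h3
  simp only [hq, hkk]
  rw [hb, ← hk w]

/-- A digit cocycle: a primitive of the increments. -/
structure IsDigitCocycle (ψ : ZMod 2 → ZMod 2) (e β : ℤ_[2] → ZMod 2) : Prop
    extends IsIncrement ψ e where
  step : ∀ w, β w = β (w - 1) + e w

theorem exists_isDigitCocycle (hψ : ψ 1 = 1) : ∃ e β, IsDigitCocycle ψ e β := by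
  obtain ⟨e, he⟩ := exists_isIncrement hψ
  obtain ⟨β, hβ⟩ := exists_coboundary e
  exact ⟨e, β, he, hβ⟩

end Arithmetic

/-! ### Independence of digit cocycles along different orbits -/

section Independence

/-- The two ends of `ℤ`. -/
noncomputable def dir (d : Bool) : Filter ℤ := cond d atTop atBot

instance dir_neBot (d : Bool) : (dir d).NeBot := by
  cases d <;> simp only [dir, cond_true, cond_false] <;> infer_instance

theorem dir_tendsto (d : Bool) {k : ℤ} (hk : 0 < k) (c : ℤ) :
    Tendsto (fun a : ℤ => k * a + c) (dir d) (dir d) := by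
  cases d
  · refine tendsto_atBot_atBot.2 fun b => ⟨-|b - c|, fun a ha => ?_⟩
    have := neg_abs_le (b - c)
    nlinarith [abs_nonneg (b - c)]
  · refine tendsto_atTop_atTop.2 fun b => ⟨|b - c|, fun a ha => ?_⟩
    have := le_abs_self (b - c)
    nlinarith [abs_nonneg (b - c)]

theorem dir_tendsto_add (d : Bool) (c : ℤ) : Tendsto (fun a : ℤ => a + c) (dir d) (dir d) := by
  simpa using dir_tendsto d one_pos c

theorem dir_ne (d : Bool) (m : ℤ) : ∀ᶠ a in dir d, a ≠ m := by
  cases d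
  · exact eventually_ne_atBot m
  · exact eventually_ne_atTop m

theorem dir_add_ne_zero (d : Bool) (w : ℤ_[2]) : ∀ᶠ a : ℤ in dir d, w + a ≠ 0 := by
  by_cases h : ∃ m : ℤ, w + m = 0
  · obtain ⟨m, hm⟩ := h
    filter_upwards [dir_ne d m] with a ha h0
    refine ha ?_
    have : (a : ℤ_[2]) = m := by linear_combination h0 - hm
    exact_mod_cast this
  · push Not at h
    exact Eventually.of_forall h

theorem dir_const {d : Bool} {g : ℤ → ZMod 2} (h : ∀ᶠ a in dir d, g a = g (a - 1)) :
    ∃ c, ∀ᶠ a in dir d, g a = c := by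
  cases d
  · obtain ⟨N, hN⟩ := eventually_atBot.1 h
    refine ⟨g N, eventually_atBot.2 ⟨N, fun a ha => ?_⟩⟩
    induction a, ha using Int.leInductionDown with
    | base => rfl
    | pred n hn ih => rw [← ih, hN n hn]
  · obtain ⟨N, hN⟩ := eventually_atTop.1 h
    refine ⟨g N, eventually_atTop.2 ⟨N, fun a ha => ?_⟩⟩
    induction a, ha using Int.leInduction with
    | base => rfl
    | succ n hn ih => rw [hN (n + 1) (by omega), add_sub_cancel_right, ih]

theorem exists_int_sub_dvd (k : ℕ) (y : ℤ_[2]) : ∃ m : ℤ, (2 : ℤ_[2]) ^ k ∣ y - m := by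
  induction k generalizing y with
  | zero => exact ⟨0, by simp⟩
  | succ k ih =>
    obtain ⟨h, hh⟩ := exists_half y
    obtain ⟨m, c, hc⟩ := ih h
    have hc' : h = m + 2 ^ k * c := by rw [← hc]; ring
    rcases hh with rfl | rfl
    · exact ⟨2 * m, c, by rw [hc']; push_cast; ring⟩
    · exact ⟨2 * m + 1, c, by rw [hc']; push_cast; ring⟩

variable {ψ : ZMod 2 → ZMod 2} {e β : ℤ_[2] → ZMod 2}

theorem IsDigitCocycle.odd_apply (h : IsDigitCocycle ψ e β) (w : ℤ_[2]) :
    β (2 * w + 1) = β (2 * w) + ψ (bit w) := by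
  rw [h.step, add_sub_cancel_right, h.odd]

theorem IsDigitCocycle.even_step (h : IsDigitCocycle ψ e β) {w : ℤ_[2]} (hw : w ≠ 0) :
    β (2 * w) = β (2 * (w - 1)) + e w := by
  have h1 := h.odd_apply (w - 1)
  rw [show 2 * (w - 1) + 1 = 2 * w - 1 by ring] at h1
  rw [h.step, h1, h.even w hw]
  simp only [bit, map_sub, map_one]
  ring

/-- Both sides have the same increments in `a` except possibly where w + a = 0, so they differ by a
constant towards each end. -/
theorem IsDigitCocycle.even_apply (h : IsDigitCocycle ψ e β) (d : Bool) (w : ℤ_[2]) :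
    ∃ c, ∀ᶠ a : ℤ in dir d, β (2 * (w + a)) = β (w + a) + c := by
  obtain ⟨c, hc⟩ := dir_const (d := d) (g := fun a : ℤ => β (2 * (w + a)) - β (w + a)) (by
    filter_upwards [dir_add_ne_zero d w] with a ha
    have h2 := h.even_step ha
    have h3 := h.step (w + a)
    rw [show w + ((a - 1 : ℤ) : ℤ_[2]) = w + a - 1 by push_cast; ring, h2, h3]
    ring)
  exact ⟨c, hc.mono fun a ha => by rw [← ha]; ring⟩

/-- Eventual periodicity, at one end of `ℤ`, with period `2ˢ`. -/
def EvPer (d : Bool) (F : ℤ → ZMod 2) (s : ℕ) : Prop := ∀ᶠ a in dir d, F (a + 2 ^ s) = F a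

theorem EvPer.succ {d : Bool} {F : ℤ → ZMod 2} {s : ℕ} (h : EvPer d F s) : EvPer d F (s + 1) := by
  filter_upwards [h, (dir_tendsto_add d (2 ^ s)).eventually h] with a h1 h2
  rw [← h1, ← h2]; congr 1; ring

theorem EvPer.mono {d : Bool} {F : ℤ → ZMod 2} {s t : ℕ} (hst : s ≤ t) (h : EvPer d F s) :
    EvPer d F t := by
  induction t, hst using Nat.le_induction with
  | base => exact h
  | succ n _ ih => exact ih.succ

theorem EvPer.sub {d : Bool} {F G : ℤ → ZMod 2} {s : ℕ} (h : EvPer d F s) (h' : EvPer d G s) :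
    EvPer d (fun a => F a - G a) s := by
  filter_upwards [h, h'] with a h1 h2
  rw [h1, h2]

theorem EvPer.congr {d : Bool} {F G : ℤ → ZMod 2} {s : ℕ} (h : EvPer d F s)
    (hFG : ∀ᶠ a in dir d, F a = G a) : EvPer d G s := by
  filter_upwards [h, hFG, (dir_tendsto_add d (2 ^ s)).eventually hFG] with a h1 h2 h3
  rw [← h2, ← h3, h1]

theorem EvPer.affine {d : Bool} {F : ℤ → ZMod 2} {s : ℕ} (h : EvPer d F (s + 1)) (c : ℤ) :
    EvPer d (fun a => F (2 * a + c)) s := by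
  filter_upwards [(dir_tendsto d two_pos c).eventually h] with a h1
  rw [← h1]; congr 1; ring

/-- The increase of `G` over one period is eventually a constant `c`, and 2c = 0, so doubling the
period suffices. -/
theorem EvPer.of_difference {d : Bool} {G : ℤ → ZMod 2} {s : ℕ}
    (h : EvPer d (fun a => G (a + 1) - G a) s) : EvPer d G (s + 1) := by
  obtain ⟨c, hc⟩ := dir_const (d := d) (g := fun a => G (a + 2 ^ s) - G a) (by
    filter_upwards [(dir_tendsto_add d (-1)).eventually h] with a h1
    rw [show a + -1 + 2 ^ s + 1 = a + 2 ^ s by ring, show a + -1 + 1 = a by ring,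
      show a + -1 + 2 ^ s = a - 1 + 2 ^ s by ring, show a + -1 = a - 1 by ring] at h1
    linear_combination h1)
  filter_upwards [hc, (dir_tendsto_add d (2 ^ s)).eventually hc] with a h1 h2
  rw [pow_succ, mul_two, ← add_assoc]
  linear_combination h1 + h2 + zmod_two_add_self c

/-- Desubstitution at even and odd places. -/
theorem IsDigitCocycle.halve (h : IsDigitCocycle ψ e β) (d : Bool) {y y' : ℤ_[2]} {q : Bool}
    (hy : y = 2 * y' + (cond q 1 0 : ℤ)) :
    (∃ p : ℤ → ZMod 2, EvPer d p 1 ∧ ∀ᶠ a : ℤ in dir d,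
      β (y + (2 * a + 0 : ℤ)) = β (y' + a) + p a) ∧
    (∃ p : ℤ → ZMod 2, EvPer d p 1 ∧ ∀ᶠ a : ℤ in dir d,
      β (y + (2 * a + 1 : ℤ)) = β (y' + (a + cond q 1 0 : ℤ)) + p a) := by
  have hper : ∀ c, EvPer d (fun a : ℤ => c + ψ (bit (y' + a))) 1 := by
    intro c
    refine Eventually.of_forall fun a => ?_
    have : y' + ((a + 2 ^ 1 : ℤ) : ℤ_[2]) = (y' + a) + 2 * 1 := by push_cast; ring
    have h2 := bit_two_mul 1
    dsimp only
    rw [this]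
    simp only [bit, map_add] at h2 ⊢
    rw [h2, add_zero]
  have hconst : ∀ c : ZMod 2, EvPer d (fun _ : ℤ => c) 1 := fun c =>
    Eventually.of_forall fun a => rfl
  obtain ⟨c, hc⟩ := h.even_apply d y'
  cases q
  · have hy0 : y = 2 * y' := by simpa using hy
    subst hy0
    refine ⟨⟨fun _ => c, hconst c, ?_⟩, ⟨_, hper c, ?_⟩⟩
    · filter_upwards [hc] with a ha
      rw [← ha]; congr 1; push_cast; ring
    · filter_upwards [hc] with a ha
      rw [show 2 * y' + ((2 * a + 1 : ℤ) : ℤ_[2]) = 2 * (y' + a) + 1 by push_cast; ring,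
        h.odd_apply, ha]
      simp [add_assoc]
  · have hy0 : y = 2 * y' + 1 := by simpa using hy
    subst hy0
    refine ⟨⟨_, hper c, ?_⟩, ⟨fun _ => c, hconst c, ?_⟩⟩
    · filter_upwards [hc] with a ha
      rw [show 2 * y' + 1 + ((2 * a + 0 : ℤ) : ℤ_[2]) = 2 * (y' + a) + 1 by push_cast; ring,
        h.odd_apply, ha]
      simp [add_assoc]
    · filter_upwards [(dir_tendsto_add d 1).eventually hc] with a ha
      rw [cond_true, ← ha]; congr 1; push_cast; ring

theorem EvPer.sum {ι : Type*} {d : Bool} {J : Finset ι} {F : ι → ℤ → ZMod 2} {s : ℕ}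
    (h : ∀ i, EvPer d (F i) s) : EvPer d (fun a => ∑ i ∈ J, F i a) s := by
  have := (eventually_all_finset J).2 fun i _ => h i
  filter_upwards [this] with a ha
  exact Finset.sum_congr rfl ha

/-- Up to terms of period 2, the even places of the sum give the sum over the halved points. The odd
places give the same with the odd points advanced by one more step. The difference of the two is the
increment of the sum over the odd points alone; summing it doubles the period, which is why the
second exponent does not drop. -/
theorem IsDigitCocycle.halve_sum {ι : Type*} (h : IsDigitCocycle ψ e β) (d : Bool)
    {y y' : ι → ℤ_[2]} {q : ι → Bool} (hy : ∀ i, y i = 2 * y' i + (cond (q i) 1 0 : ℤ))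
    (J : Finset ι) {s : ℕ} (hs : EvPer d (fun a : ℤ => ∑ i ∈ J, β (y i + a)) (s + 2)) :
    EvPer d (fun a : ℤ => ∑ i ∈ J, β (y' i + a)) (s + 1) ∧
    EvPer d (fun a : ℤ => ∑ i ∈ J.filter (fun i => q i = true), β (y' i + a)) (s + 2) := by
  choose p hp hp' using fun i => (h.halve d (hy i)).1
  choose r hr hr' using fun i => (h.halve d (hy i)).2
  have hA : EvPer d (fun a : ℤ => ∑ i ∈ J, β (y' i + a)) (s + 1) := by
    refine ((hs.affine 0).sub (EvPer.sum (J := J) fun i => (hp i).mono (by omega))).congr ?_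
    filter_upwards [(eventually_all_finset J).2 fun i _ => hp' i] with a ha
    rw [Finset.sum_congr rfl ha, Finset.sum_add_distrib]
    ring
  have hB : EvPer d (fun a : ℤ => ∑ i ∈ J, β (y' i + (a + cond (q i) 1 0 : ℤ))) (s + 1) := by
    refine ((hs.affine 1).sub (EvPer.sum (J := J) fun i => (hr i).mono (by omega))).congr ?_
    filter_upwards [(eventually_all_finset J).2 fun i _ => hr' i] with a ha
    rw [Finset.sum_congr rfl ha, Finset.sum_add_distrib]
    ring
  refine ⟨hA, EvPer.of_difference ((hB.sub hA).congr (Eventually.of_forall fun a => ?_))⟩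
  rw [← Finset.sum_sub_distrib, ← Finset.sum_sub_distrib, Finset.sum_filter]
  refine Finset.sum_congr rfl fun i _ => ?_
  cases q i <;> simp

theorem exists_half_bool (w : ℤ_[2]) : ∃ (h : ℤ_[2]) (q : Bool), w = 2 * h + (cond q 1 0 : ℤ) := by
  obtain ⟨h, hh | hh⟩ := exists_half w
  · exact ⟨h, false, by simpa using hh⟩
  · exact ⟨h, true, by simpa using hh⟩

theorem IsDigitCocycle.not_evPer_one (h : IsDigitCocycle ψ e β) (d : Bool) (y : ℤ_[2]) :
    ¬ EvPer d (fun a : ℤ => β (y + a)) 1 := by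
  intro hs
  obtain ⟨c, hc⟩ := dir_const (d := d) (g := fun a : ℤ => e (y + a)) (by
    filter_upwards [(dir_tendsto_add d (-2)).eventually hs] with a ha
    have h1 := h.step (y + a)
    have h2 := h.step (y + a - 1)
    rw [show y + ((a + -2 + 2 ^ 1 : ℤ) : ℤ_[2]) = y + a by push_cast; ring,
      show y + ((a + -2 : ℤ) : ℤ_[2]) = y + a - 1 - 1 by push_cast; ring] at ha
    rw [show y + ((a - 1 : ℤ) : ℤ_[2]) = y + a - 1 by push_cast; ring]
    linear_combination ha - h1 - h2 - zmod_two_add_self (e (y + a - 1)))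
  -- Period 2 for `β` makes `e` eventually constant along the orbit, which meets every class modulo
  -- 8. But `e` is 1 on the class of 3 and 0 on the class of 2 = 2·1, whatever ψ 0 is.
  obtain ⟨m, k, hk⟩ := exists_int_sub_dvd 3 y
  have hval : ∀ r : ℤ, ∃ b : ℤ_[2], e (r + 8 * b) = c := by
    intro r
    obtain ⟨a, ha⟩ := ((dir_tendsto d (show (0 : ℤ) < 8 by norm_num) (r - m)).eventually hc).exists
    refine ⟨a + k, ?_⟩
    rw [← ha]
    congr 1
    push_cast
    linear_combination -hk
  obtain ⟨b, hb⟩ := hval 3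
  obtain ⟨b', hb'⟩ := hval 2
  have h3 := h.three_add_four_mul (2 * b)
  have h2 := h.pow_mul_one_add 0 b'
  rw [show 3 + 4 * (2 * b) = ((3 : ℤ) : ℤ_[2]) + 8 * b by push_cast; ring, hb] at h3
  rw [show 2 ^ (0 + 1) * (1 + 4 * b') = ((2 : ℤ) : ℤ_[2]) + 8 * b' by push_cast; ring, hb', h3] at h2
  exact absurd h2 (by decide)

theorem IsDigitCocycle.not_evPer_single (h : IsDigitCocycle ψ e β) (d : Bool) (y : ℤ_[2]) (s : ℕ) :
    ¬ EvPer d (fun a : ℤ => β (y + a)) (s + 1) := by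
  induction s generalizing y with
  | zero => exact h.not_evPer_one d y
  | succ s ih =>
    intro hs
    obtain ⟨y', q, hy⟩ := exists_half_bool y
    refine ih y' ?_
    simpa using (h.halve_sum (ι := Unit) d (y := fun _ => y) (y' := fun _ => y') (q := fun _ => q)
      (fun _ => hy) {()} (by simpa using hs)).1

/-- Sums of digit cocycles along different points are not eventually periodic with period
a power of two. -/
theorem IsDigitCocycle.not_evPer {ι : Type*} (h : IsDigitCocycle ψ e β) (d : Bool) (n : ℕ) :
    ∀ (J : Finset ι) (y : ι → ℤ_[2]), J.card = n → J.Nonempty → Set.InjOn y J → ∀ s,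
      ¬ EvPer d (fun a : ℤ => ∑ i ∈ J, β (y i + a)) (s + 2) := by
  induction n using Nat.strong_induction_on with
  | _ n ih =>
    intro J y hJ hne hinj s hs
    rcases Nat.lt_or_ge 1 J.card with hcard | hcard
    · obtain ⟨i, hi, j, hj, hij⟩ := Finset.one_lt_card.1 hcard
      have hyij : y i - y j ≠ 0 := sub_ne_zero.2 fun h' => hij (hinj hi hj h')
      obtain ⟨k, hk⟩ := exists_not_pow_dvd hyij
      clear hyij
      induction k generalizing y s with
      | zero => exact hk (by simp)
      | succ k ihk =>
        choose y' q hy using fun i => exists_half_bool (y i)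
        have hinj' : ∀ b : Bool, Set.InjOn y' {i | i ∈ J ∧ q i = b} := by
          rintro b i ⟨hi, hib⟩ j ⟨hj, hjb⟩ hij
          refine hinj hi hj ?_
          rw [hy i, hy j, hij, hib, hjb]
        obtain ⟨h1, h2⟩ := h.halve_sum d hy J hs
        -- If all parities agree, halving brings the chosen pair of points one step closer to being
        -- separated modulo 2. Otherwise the odd points form a smaller nonempty set whose sum has
        -- the same period, and the induction on cardinality applies.
        by_cases hall : ∃ b : Bool, ∀ i ∈ J, q i = b
        · obtain ⟨b, hb⟩ := hall
          refine ihk y' ((hinj' b).mono (show (J : Set ι) ⊆ _ from fun i hi => And.intro hi (hb i hi))) s h1.succ ?_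
          intro hd
          refine hk ?_
          rw [hy i, hy j, hb i hi, hb j hj, pow_succ']
          rw [show 2 * y' i + ((cond b 1 0 : ℤ) : ℤ_[2]) - (2 * y' j + ((cond b 1 0 : ℤ) : ℤ_[2])) =
            2 * (y' i - y' j) by ring]
          exact mul_dvd_mul_left 2 hd
        · push Not at hall
          obtain ⟨i1, hi1, hq1⟩ := hall false
          obtain ⟨i0, hi0, hq0⟩ := hall true
          refine ih _ ?_ (J.filter fun i => q i = true) y' rfl
            ⟨i1, Finset.mem_filter.2 ⟨hi1, by simpa using hq1⟩⟩ ((hinj' true).mono fun i hi => Finset.mem_filter.1 hi) s h2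
          rw [← hJ]
          exact Finset.card_lt_card ⟨Finset.filter_subset _ _, fun hsub =>
            hq0 (Finset.mem_filter.1 (hsub hi0)).2⟩
    · obtain ⟨i, rfl⟩ := Finset.card_eq_one.1 (le_antisymm hcard hne.card_pos)
      exact h.not_evPer_single d (y i) (s + 1) (by simpa using hs)

end Independence

/-! ### Realising arbitrary sign vectors along different orbits. -/

section SignVectors

variable {ψ : ZMod 2 → ZMod 2} {e β : ℤ_[2] → ZMod 2}

/-- The integers that are 2-adically close to `z`. -/
noncomputable def padicFilter (z : ℤ_[2]) : Filter ℤ := comap (fun n : ℤ => (n : ℤ_[2])) (𝓝 z)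

theorem mem_padicFilter {z : ℤ_[2]} {U : Set ℤ} :
    U ∈ padicFilter z ↔ ∃ k : ℕ, ∀ n : ℤ, (2 : ℤ_[2]) ^ k ∣ n - z → n ∈ U := by
  rw [padicFilter, mem_comap]
  constructor
  · rintro ⟨V, hV, hVU⟩
    obtain ⟨k, hk⟩ := mem_nhds_iff_pow.1 hV
    exact ⟨k, fun n hn => hVU (hk n hn)⟩
  · rintro ⟨k, hk⟩
    exact ⟨{u | (2 : ℤ_[2]) ^ k ∣ u - z}, mem_nhds_iff_pow.2 ⟨k, fun u hu => hu⟩, hk⟩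

theorem tendsto_padicFilter (z : ℤ_[2]) :
    Tendsto (fun n : ℤ => (n : ℤ_[2])) (padicFilter z) (𝓝 z) := tendsto_comap

theorem eventually_pow_mul {d : Bool} {P : ℤ → Prop} (h : ∀ᶠ n in dir d ⊓ padicFilter 0, P n) :
    ∃ t : ℕ, ∀ᶠ a in dir d, P (2 ^ t * a) := by
  obtain ⟨A, hA, B, hB, hAB⟩ := mem_inf_iff_superset.1 h
  obtain ⟨k, hk⟩ := mem_padicFilter.1 hB
  refine ⟨k, ?_⟩
  have := (dir_tendsto d (show (0 : ℤ) < 2 ^ k by positivity) 0).eventually hA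
  filter_upwards [this] with a ha
  exact hAB ⟨by rw [add_zero] at ha; exact ha, hk _ ⟨a, by push_cast; ring⟩⟩

instance dir_inf_padicFilter_zero_neBot (d : Bool) : (dir d ⊓ padicFilter 0).NeBot := by
  refine ⟨fun h => ?_⟩
  have h1 : ∀ᶠ n in dir d ⊓ padicFilter 0, False := by rw [h]; exact eventually_bot
  obtain ⟨t, ht⟩ := eventually_pow_mul h1
  exact ht.exists.elim fun _ h => h

/-- Sampling at even places amounts to halving the points, up to terms of period 2, so the factor 2ᵗ
is removed one step at a time. Distinctness alone would not survive, since 0 and 1 have the same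
half; lying on different orbits does. -/
theorem IsDigitCocycle.not_evPer_pow_mul {ι : Type*} (h : IsDigitCocycle ψ e β) (d : Bool)
    {J : Finset ι} (hne : J.Nonempty) (s t : ℕ) (y : ι → ℤ_[2])
    (hy : ∀ i ∈ J, ∀ j ∈ J, ∀ n : ℤ, y i = y j + n → i = j) :
    ¬ EvPer d (fun a : ℤ => ∑ i ∈ J, β (y i + (2 ^ t * a : ℤ))) (s + 2) := by
  induction t generalizing y with
  | zero =>
    intro hs
    refine h.not_evPer d _ J y rfl hne (fun i hi j hj hij => hy i hi j hj 0 (by simpa using hij)) s ?_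
    simpa using hs
  | succ t ih =>
    intro hs
    choose y' q hq using fun i => exists_half_bool (y i)
    refine ih y' (fun i hi j hj n hn => hy i hi j hj
      (2 * n + (cond (q i) 1 0 : ℤ) - (cond (q j) 1 0 : ℤ)) ?_) ?_
    · rw [hq i, hq j, hn]; push_cast; ring
    · choose p hp hp' using fun i => (h.halve d (hq i)).1
      have hT := dir_tendsto d (show (0 : ℤ) < 2 ^ t by positivity) 0
      have hper : EvPer d (fun a => ∑ i ∈ J, p i (2 ^ t * a)) (s + 2) := by
        refine EvPer.sum fun i => ?_
        have h1 : EvPer d (p i) (t + (s + 2)) := (hp i).mono (by omega)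
        filter_upwards [hT.eventually h1] with a ha
        rw [add_zero] at ha
        rw [← ha]; congr 1; ring
      refine (hs.sub hper).congr ?_
      filter_upwards [hT.eventually ((eventually_all_finset J).2 fun i _ => hp' i)] with a ha
      rw [← Finset.sum_sub_distrib]
      refine Finset.sum_congr rfl fun i hi => ?_
      have := ha i hi
      rw [add_zero, add_zero, ← mul_assoc, ← pow_succ'] at this
      rw [this, add_sub_cancel_right]

/-- Away from `0`, the translation of a digit cocycle is locally constant. -/
theorem IsDigitCocycle.eventually_sub (h : IsDigitCocycle ψ e β) {d : Bool} {y : ℤ_[2]}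
    (hy : ∀ j : ℤ, cond d (0 < j) (j ≤ 0) → y + j ≠ 0) {m : ℤ} (hm : cond d (0 ≤ m) (m ≤ 0)) :
    ∀ᶠ n : ℤ in padicFilter 0, β (y + n + m) - β (y + n) = β (y + m) - β y := by
  have hloc : ∀ j : ℤ, cond d (0 < j) (j ≤ 0) →
      ∀ᶠ n : ℤ in padicFilter 0, e (y + n + j) = e (y + j) := by
    intro j hj
    have h1 : Tendsto (fun n : ℤ => y + n + j) (padicFilter 0) (𝓝 (y + 0 + j)) :=
      ((tendsto_padicFilter 0).const_add y).add_const _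
    rw [add_zero] at h1
    exact h1.eventually (h.locally_constant (hy j hj))
  cases d
  · simp only [cond_false] at hm hloc
    induction m, hm using Int.leInductionDown with
    | base => simp
    | pred m hm ih =>
      filter_upwards [ih, hloc m hm] with n h1 h2
      have h3 := h.step (y + n + m)
      have h4 := h.step (y + m)
      rw [show y + n + ((m - 1 : ℤ) : ℤ_[2]) = y + n + m - 1 by push_cast; ring,
        show y + ((m - 1 : ℤ) : ℤ_[2]) = y + m - 1 by push_cast; ring]
      linear_combination h1 - h2 - h3 + h4
  · simp only [cond_true] at hm hloc
    induction m, hm using Int.leInduction with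
    | base => simp
    | succ m hm ih =>
      filter_upwards [ih, hloc (m + 1) (by omega)] with n h1 h2
      have h3 := h.step (y + n + ((m + 1 : ℤ) : ℤ_[2]))
      have h4 := h.step (y + ((m + 1 : ℤ) : ℤ_[2]))
      rw [show y + n + ((m + 1 : ℤ) : ℤ_[2]) - 1 = y + n + m by push_cast; ring] at h3
      rw [show y + ((m + 1 : ℤ) : ℤ_[2]) - 1 = y + m by push_cast; ring] at h4
      linear_combination h1 + h2 + h3 - h4

theorem frequently_exists_of_finite {α κ : Type*} [Finite κ] {l : Filter α} {P : α → Prop}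
    (h : ∃ᶠ a in l, P a) (f : α → κ) : ∃ s, ∃ᶠ a in l, P a ∧ f a = s := by
  by_contra hc
  simp only [not_exists, not_frequently] at hc
  refine h ((eventually_all.2 hc).mono fun a ha hP => ha (f a) ⟨hP, rfl⟩)

theorem dir_eventually_side (d : Bool) : ∀ᶠ n : ℤ in dir d, cond d (0 ≤ n) (n ≤ 0) := by
  cases d
  · exact eventually_le_atBot 0
  · exact eventually_ge_atTop 0

/-- Along finitely many different orbits, all sign vectors are realised by arbitrarily
far integers that are 2-adically arbitrarily small. -/
theorem IsDigitCocycle.frequently_sign {ι : Type*} [Fintype ι] (h : IsDigitCocycle ψ e β)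
    (d : Bool) {y : ι → ℤ_[2]} (hy : ∀ i j, ∀ n : ℤ, y i = y j + n → i = j)
    (hok : ∀ i, ∀ j : ℤ, cond d (0 < j) (j ≤ 0) → y i + j ≠ 0) (s : ι → ZMod 2) :
    ∃ᶠ n : ℤ in dir d ⊓ padicFilter 0, ∀ i, β (y i + n) = β (y i) + s i := by
  classical
  let P : (ι → ZMod 2) → Prop := fun s =>
    ∃ᶠ n : ℤ in dir d ⊓ padicFilter 0, ∀ i, β (y i + n) = β (y i) + s i
  -- First `m` is fixed to realise `s`. Then `n` realising `s'` is taken so small 2-adically that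
  -- moving by `m` changes `β` equally from y + n and from y; n + m realises the sum.
  have hadd : ∀ s s', P s → P s' → P (s + s') := by
    intro s s' hs hs'
    refine frequently_iff.2 fun {U} hU => ?_
    obtain ⟨A, hA, B, hB, hAB⟩ := mem_inf_iff_superset.1 hU
    obtain ⟨k, hk⟩ := mem_padicFilter.1 hB
    have hside : ∀ᶠ n : ℤ in dir d ⊓ padicFilter 0,
        cond d (0 ≤ n) (n ≤ 0) ∧ (2 : ℤ_[2]) ^ k ∣ n := by
      refine ((dir_eventually_side d).filter_mono inf_le_left).and (Filter.Eventually.filter_mono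
        inf_le_right (mem_padicFilter.2 ⟨k, fun n hn => by simpa using hn⟩))
    obtain ⟨m, hm, hm0, hmk⟩ := (hs.and_eventually hside).exists
    have hev : ∀ᶠ n : ℤ in dir d ⊓ padicFilter 0,
        n + m ∈ U ∧ ∀ i, β (y i + n + m) - β (y i + n) = β (y i + m) - β (y i) := by
      refine Eventually.and ?_ (eventually_all.2 fun i =>
        (h.eventually_sub (hok i) hm0).filter_mono inf_le_right)
      have h1 : ∀ᶠ n : ℤ in dir d ⊓ padicFilter 0, n + m ∈ A :=
        ((dir_tendsto_add d m).eventually hA).filter_mono inf_le_left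
      have h2 : ∀ᶠ n : ℤ in dir d ⊓ padicFilter 0, (2 : ℤ_[2]) ^ k ∣ n :=
        Filter.Eventually.filter_mono
          inf_le_right (mem_padicFilter.2 ⟨k, fun n hn => by simpa using hn⟩)
      filter_upwards [h1, h2] with n hn1 hn2
      refine hAB ⟨hn1, hk _ ?_⟩
      push_cast
      rw [sub_zero]
      exact dvd_add hn2 hmk
    obtain ⟨n, hn, hnU, hne⟩ := (hs'.and_eventually hev).exists
    refine ⟨n + m, hnU, fun i => ?_⟩
    have h1 := hn i
    have h2 := hm i
    have h3 := hne i
    rw [show y i + ((n + m : ℤ) : ℤ_[2]) = y i + n + m by push_cast; ring, Pi.add_apply]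
    linear_combination h1 + h2 + h3
  have hex : ∀ Q : ℤ → Prop, (∃ᶠ n in dir d ⊓ padicFilter 0, Q n) →
      ∃ s : ι → ZMod 2, ∃ᶠ n : ℤ in dir d ⊓ padicFilter 0, Q n ∧ ∀ i, β (y i + n) = β (y i) + s i := by
    intro Q hQ
    obtain ⟨s, hs⟩ := frequently_exists_of_finite hQ fun n : ℤ => fun i => β (y i + n) - β (y i)
    refine ⟨s, hs.mono ?_⟩
    rintro n ⟨hn, rfl⟩
    exact ⟨hn, fun i => by ring⟩
  have hzero : P 0 := by
    obtain ⟨s, hs⟩ := hex (fun _ => True) (Eventually.frequently (Eventually.of_forall fun _ => trivial))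
    have hs : P s := hs.mono fun n hn => hn.2
    have := hadd s s hs hs
    rwa [show s + s = 0 from funext fun i => zmod_two_add_self (s i)] at this
  let V : Submodule (ZMod 2) (ι → ZMod 2) :=
    { carrier := {s | P s}
      add_mem' := fun {a b} ha hb => hadd a b ha hb
      zero_mem' := hzero
      smul_mem' := fun c s hs => by
        rcases zmod_two_cases c with rfl | rfl
        · simpa using hzero
        · simpa using hs }
  suffices hV : V = ⊤ by
    have : s ∈ V := by rw [hV]; trivial
    exact this
  -- If the realised vectors formed a proper subspace, a nonzero functional, that is the sum over a
  -- nonempty set `J` of coordinates, would vanish on it. By finiteness of the set of sign vectors,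
  -- Σ β(y i + n) over `J` would then be eventually constant, against the absence of periods.
  by_contra hV
  obtain ⟨f, hf0, hf⟩ := Submodule.exists_le_ker_of_lt_top V (lt_top_iff_ne_top.2 hV)
  have hfs : ∀ v, f v = ∑ i ∈ Finset.univ.filter (fun i => f (Pi.single i 1) = 1), v i := by
    intro v
    rw [LinearMap.pi_apply_eq_sum_univ f v, Finset.sum_filter]
    refine Finset.sum_congr rfl fun i _ => ?_
    have : (fun j => if i = j then (1 : ZMod 2) else 0) = Pi.single i 1 := by
      ext j; simp [Pi.single_apply, eq_comm]
    rw [this]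
    rcases zmod_two_cases (f (Pi.single i 1)) with h0 | h0 <;> simp [h0]
  set J := Finset.univ.filter (fun i => f (Pi.single i 1) = 1) with hJ
  have hne : J.Nonempty := by
    by_contra hemp
    rw [Finset.not_nonempty_iff_eq_empty] at hemp
    exact hf0 (LinearMap.ext fun v => by rw [hfs, hemp]; simp)
  have hfreq : ∃ᶠ n : ℤ in dir d ⊓ padicFilter 0,
      ∑ i ∈ J, β (y i + n) ≠ ∑ i ∈ J, β (y i) := by
    intro hc
    simp only [not_not] at hc
    obtain ⟨t, ht⟩ := eventually_pow_mul hc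
    refine h.not_evPer_pow_mul d hne 0 t y (fun i _ j _ => hy i j) ?_
    filter_upwards [ht, (dir_tendsto_add d (2 ^ (0 + 2))).eventually ht] with a h1 h2
    rw [h1, h2]
  obtain ⟨s', hs'⟩ := hex _ hfreq
  have hs'V : s' ∈ V := (hs'.mono fun n hn => hn.2 : P s')
  obtain ⟨n, hn1, hn2⟩ := hs'.exists
  apply hn1
  rw [Finset.sum_congr rfl fun i _ => hn2 i, Finset.sum_add_distrib, ← hfs s']
  rw [show f s' = 0 from hf hs'V, add_zero]

/-- Integers tending to an end and 2-adically to `z` with prescribed increment at `n - z`. -/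
theorem IsIncrement.frequently_eq (h : IsIncrement ψ e) (d : Bool) (z : ℤ_[2]) (i : ZMod 2) :
    ∃ᶠ n : ℤ in dir d ⊓ padicFilter z, e (n - z) = i := by
  refine frequently_iff.2 fun {U} hU => ?_
  obtain ⟨A, hA, B, hB, hAB⟩ := mem_inf_iff_superset.1 hU
  obtain ⟨k, hk⟩ := mem_padicFilter.1 hB
  -- The integer sought is n = z + 2ᵗ⁺¹(1 + 4·), where the increment at n - z is `t` modulo 2: `t`
  -- large gives 2-adic closeness to `z`, its parity gives the value.
  obtain ⟨t, hkt, hti⟩ : ∃ t : ℕ, k ≤ t + 1 ∧ (t : ZMod 2) = i := by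
    rcases zmod_two_cases i with rfl | rfl
    · exact ⟨2 * k, by omega, by push_cast; rw [two_mul]; exact zmod_two_add_self _⟩
    · exact ⟨2 * k + 1, by omega, by push_cast; rw [two_mul, zmod_two_add_self, zero_add]⟩
  obtain ⟨m, c, hc⟩ := exists_int_sub_dvd (t + 3) z
  obtain ⟨a, ha⟩ := ((dir_tendsto d (show (0 : ℤ) < 2 ^ (t + 3) by positivity)
    (m + 2 ^ (t + 1))).eventually hA).exists
  have hval : ((2 ^ (t + 3) * a + (m + 2 ^ (t + 1)) : ℤ) : ℤ_[2]) - z =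
      2 ^ (t + 1) * (1 + 4 * (a - c)) := by
    push_cast
    linear_combination -hc
  refine ⟨_, hAB ⟨ha, hk _ ?_⟩, ?_⟩
  · rw [hval]
    exact Dvd.dvd.mul_right (pow_dvd_pow 2 hkt) _
  · rw [hval, h.pow_mul_one_add, hti]

end SignVectors

/-! ### Extensions of the odometer by a digit cocycle -/

section Model

variable {X : Type} [TopologicalSpace X]

theorem zpow_add_apply' (σ : X ≃ₜ X) (m n : ℤ) (x : X) : (σ ^ (m + n)) x = (σ ^ m) ((σ ^ n) x) := by
  rw [zpow_add]; rfl

theorem semiconj_zpow {Y : Type} [TopologicalSpace Y] {σ : X ≃ₜ X} {δ : Y ≃ₜ Y} {f : X → Y}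
    (h : ∀ x, f (σ x) = δ (f x)) (n : ℤ) (x : X) : f ((σ ^ n) x) = (δ ^ n) (f x) := by
  have hn : ∀ (n : ℕ) (x : X), f ((σ ^ (n : ℤ)) x) = (δ ^ (n : ℤ)) (f x) := by
    intro n
    induction n with
    | zero => intro x; simp
    | succ n ih =>
      intro x
      rw [Nat.cast_succ, add_comm (n : ℤ) 1, zpow_add_apply', zpow_add_apply', zpow_one, zpow_one,
        h, ih]
  obtain ⟨m, rfl | rfl⟩ := n.eq_nat_or_neg
  · exact hn m x
  · have := hn m ((σ ^ (-m : ℤ)) x)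
    rw [← zpow_add_apply', add_neg_cancel, zpow_zero] at this
    have h2 : f x = (δ ^ (m : ℤ)) (f ((σ ^ (-m : ℤ)) x)) := this
    rw [h2, ← zpow_add_apply', neg_add_cancel, zpow_zero]
    rfl

/-- The 2-adic odometer. -/
noncomputable def odometer : ℤ_[2] ≃ₜ ℤ_[2] := Homeomorph.addRight 1

theorem odometer_apply (w : ℤ_[2]) : odometer w = w + 1 := rfl

theorem odometer_zpow (n : ℤ) (w : ℤ_[2]) : (odometer ^ n) w = w + n := by
  induction n using Int.induction_on generalizing w with
  | zero => simp
  | succ n ih =>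
    rw [zpow_add_apply', ih, zpow_one, odometer_apply]; push_cast; ring
  | pred n ih =>
    have h1 : (odometer ^ (-1 : ℤ)) w = w - 1 := by
      refine odometer.injective ?_
      have := zpow_add_apply' odometer 1 (-1) w
      rw [add_neg_cancel, zpow_zero, zpow_one] at this
      rw [← this, odometer_apply, sub_add_cancel]
      rfl
    rw [sub_eq_add_neg, zpow_add_apply', ih, h1]; push_cast; ring

/-- The system `σ` is a copy of the extension of the 2-adic odometer by sign sequences whose
increments are given by `e`; `π` is the projection and `v` is the sign at the origin. -/
structure IsModel (e : ℤ_[2] → ZMod 2) (σ : X ≃ₜ X) (π : X → ℤ_[2]) (v : X → ZMod 2) : Prop where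
  continuous_proj : Continuous π
  continuous_sign : Continuous v
  proj_shift : ∀ x, π (σ x) = π x + 1
  ext : ∀ x x', π x = π x' → (∀ n : ℤ, v ((σ ^ n) x) = v ((σ ^ n) x')) → x = x'
  sign_step : ∀ x, π (σ x) ≠ 0 → v (σ x) = v x + e (π (σ x))
  exists_point : ∀ (y : ℤ_[2]) (s : ℤ → ZMod 2),
    (∀ n : ℤ, y + n ≠ 0 → s n = s (n - 1) + e (y + n)) →
      ∃ x, π x = y ∧ ∀ n : ℤ, v ((σ ^ n) x) = s n

variable {ψ : ZMod 2 → ZMod 2} {e β : ℤ_[2] → ZMod 2} {σ : X ≃ₜ X} {π : X → ℤ_[2]} {v : X → ZMod 2}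

theorem IsModel.proj_zpow (h : IsModel e σ π v) (n : ℤ) (x : X) : π ((σ ^ n) x) = π x + n := by
  rw [← odometer_zpow]
  exact semiconj_zpow h.proj_shift n x

theorem IsModel.sign_zpow_step (h : IsModel e σ π v) (n : ℤ) (x : X) (hn : π x + n ≠ 0) :
    v ((σ ^ n) x) = v ((σ ^ (n - 1)) x) + e (π x + n) := by
  have h1 : σ ((σ ^ (n - 1)) x) = (σ ^ n) x := by
    have := zpow_add_apply' σ 1 (n - 1) x
    rw [zpow_one] at this
    rw [← this]; congr 2; ring
  have := h.sign_step ((σ ^ (n - 1)) x)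
  rw [h1, h.proj_zpow] at this
  exact this hn

/-- Along a half-orbit which does not cross `0`, the signs follow the digit cocycle. -/
theorem IsModel.sign_zpow (h : IsModel e σ π v) (hβ : IsDigitCocycle ψ e β) {d : Bool} {x : X}
    (hx : ∀ j : ℤ, cond d (0 < j) (j ≤ 0) → π x + j ≠ 0) {m : ℤ} (hm : cond d (0 ≤ m) (m ≤ 0)) :
    v ((σ ^ m) x) = v x + (β (π x + m) - β (π x)) := by
  cases d
  · simp only [cond_false] at hm hx
    induction m, hm using Int.leInductionDown with
    | base => simp
    | pred m hm ih =>
      have h1 := h.sign_zpow_step m x (hx m hm)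
      have h2 := hβ.step (π x + m)
      rw [show π x + ((m - 1 : ℤ) : ℤ_[2]) = π x + m - 1 by push_cast; ring]
      linear_combination ih - h1 + h2
  · simp only [cond_true] at hm hx
    induction m, hm using Int.leInduction with
    | base => simp
    | succ m hm ih =>
      have h1 := h.sign_zpow_step (m + 1) x (hx (m + 1) (by omega))
      have h2 := hβ.step (π x + ((m + 1 : ℤ) : ℤ_[2]))
      rw [add_sub_cancel_right] at h1
      rw [show π x + ((m + 1 : ℤ) : ℤ_[2]) - 1 = π x + m by push_cast; ring] at h2
      linear_combination ih + h1 - h2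

/-- Twisting all signs by a constant. -/
theorem IsModel.exists_twist (h : IsModel e σ π v) (c : ZMod 2) (x : X) :
    ∃ x', π x' = π x ∧ ∀ n : ℤ, v ((σ ^ n) x') = v ((σ ^ n) x) + c :=
  h.exists_point (π x) (fun n => v ((σ ^ n) x) + c) fun n hn => by
    rw [h.sign_zpow_step n x hn]; ring

noncomputable def IsModel.twist (h : IsModel e σ π v) (c : ZMod 2) (x : X) : X :=
  (h.exists_twist c x).choose

theorem IsModel.proj_twist (h : IsModel e σ π v) (c : ZMod 2) (x : X) : π (h.twist c x) = π x :=
  (h.exists_twist c x).choose_spec.1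

theorem IsModel.sign_twist (h : IsModel e σ π v) (c : ZMod 2) (x : X) (n : ℤ) :
    v ((σ ^ n) (h.twist c x)) = v ((σ ^ n) x) + c :=
  (h.exists_twist c x).choose_spec.2 n

theorem IsModel.twist_twist (h : IsModel e σ π v) (c c' : ZMod 2) (x : X) :
    h.twist c (h.twist c' x) = h.twist (c + c') x := by
  refine h.ext _ _ ?_ fun n => ?_
  · simp only [h.proj_twist]
  · simp only [h.sign_twist]; ring

theorem IsModel.zpow_twist (h : IsModel e σ π v) (c : ZMod 2) (x : X) (m : ℤ) :
    (σ ^ m) (h.twist c x) = h.twist c ((σ ^ m) x) := by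
  refine h.ext _ _ ?_ fun n => ?_
  · simp only [h.proj_twist, h.proj_zpow]
  · simp only [h.sign_twist, ← zpow_add_apply']

/-- Two points over the same base point, with the same jump across `0`, are twists of
each other. -/
theorem IsModel.exists_eq_twist (h : IsModel e σ π v) {p q : X} (hpq : π p = π q)
    (hj : ∀ k : ℤ, π p + k = 0 →
      v ((σ ^ k) p) - v ((σ ^ (k - 1)) p) = v ((σ ^ k) q) - v ((σ ^ (k - 1)) q)) :
    ∃ c, p = h.twist c q := by
  have hstep : ∀ k : ℤ,
      v ((σ ^ k) p) - v ((σ ^ (k - 1)) p) = v ((σ ^ k) q) - v ((σ ^ (k - 1)) q) := by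
    intro k
    by_cases hk : π p + k = 0
    · exact hj k hk
    · have h1 := h.sign_zpow_step k p hk
      have h2 := h.sign_zpow_step k q (hpq ▸ hk)
      rw [← hpq] at h2
      linear_combination h1 - h2
  refine ⟨v p - v q, h.ext _ _ (by rw [h.proj_twist, hpq]) fun n => ?_⟩
  rw [h.sign_twist]
  induction n using Int.induction_on with
  | zero => simp
  | succ n ih =>
    have := hstep (n + 1)
    rw [add_sub_cancel_right] at this
    linear_combination this + ih
  | pred n ih =>
    have := hstep (-n)
    linear_combination ih - this

theorem IsModel.exists_proj_eq (h : IsModel e σ π v) (hβ : IsDigitCocycle ψ e β) (y : ℤ_[2]) :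
    ∃ x, π x = y := by
  obtain ⟨x, hx, _⟩ := h.exists_point y (fun n => β (y + n)) fun n _ => by
    have := hβ.step (y + n)
    rw [this]; congr 2; push_cast; ring
  exact ⟨x, hx⟩

/-- The place next to `0` on the side `d`. -/
def offset (d : Bool) : ℤ := cond d 0 (-1)

/-- A base point is admissible if it is `0` or not an integer. -/
def IsAdmissible (y : ℤ_[2]) : Prop := y = 0 ∨ ∀ n : ℤ, y ≠ n

theorem IsAdmissible.side {y : ℤ_[2]} (hy : IsAdmissible y) (d : Bool) (j : ℤ)
    (hj : cond d (0 < j) (j ≤ 0)) : y + (offset d : ℤ) + j ≠ 0 := by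
  intro h0
  have h1 : y = ((-(offset d + j) : ℤ) : ℤ_[2]) := by push_cast; linear_combination h0
  rcases hy with rfl | hy
  · have h2 : (0 : ℤ) = -(offset d + j) := by exact_mod_cast h1
    cases d <;> simp [offset] at h2 hj <;> omega
  · exact hy _ h1

theorem IsModel.sign_side (h : IsModel e σ π v) (hβ : IsDigitCocycle ψ e β) {d : Bool} {x : X}
    (hx : IsAdmissible (π x)) {m : ℤ} (hm : cond d (0 ≤ m) (m ≤ 0)) :
    v ((σ ^ (offset d + m)) x) = v ((σ ^ offset d) x) +
      (β (π x + (offset d : ℤ) + m) - β (π x + (offset d : ℤ))) := by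
  have := h.sign_zpow hβ (d := d) (x := (σ ^ offset d) x) (fun j hj => by
    rw [h.proj_zpow]; exact hx.side d j hj) hm
  rw [h.proj_zpow, ← zpow_add_apply', add_comm m] at this
  exact this

/-- The signs of an admissible point on the side `d`, or all signs over a non-integer. -/
theorem IsModel.sign_eq_of_side (h : IsModel e σ π v) (hβ : IsDigitCocycle ψ e β) {d : Bool}
    {x x' : X} (hx : IsAdmissible (π x)) (hxx : π x = π x')
    (hv : v ((σ ^ offset d) x) = v ((σ ^ offset d) x')) :
    ∀ᶠ n : ℤ in dir d, v ((σ ^ n) x) = v ((σ ^ n) x') := by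
  filter_upwards [(dir_tendsto_add d (-offset d)).eventually (dir_eventually_side d)] with n hn
  have h1 := h.sign_side hβ hx hn
  have h2 := h.sign_side hβ (hxx ▸ hx) hn
  rw [show offset d + (n + -offset d) = n by ring] at h1 h2
  rw [h1, h2, hv, hxx]

theorem IsModel.eq_of_sign_eq (h : IsModel e σ π v) {x x' : X} (hx : ∀ n : ℤ, π x ≠ n)
    (hxx : π x = π x') {m : ℤ} (hv : v ((σ ^ m) x) = v ((σ ^ m) x')) : x = x' := by
  obtain ⟨c, hc⟩ := h.exists_eq_twist hxx (fun k hk => absurd (by push_cast; linear_combination hk)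
    (hx (-k)))
  rw [hc, h.sign_twist] at hv
  have hc0 : c = 0 := by simpa using hv
  refine h.ext _ _ hxx fun n => ?_
  rw [hc, h.sign_twist, hc0, add_zero]

end Model

/-! ### Elements of the Ellis semigroup as limits along ultrafilters on ℤ. -/

section Ellis

variable {X : Type} [TopologicalSpace X] {σ : X ≃ₜ X}

theorem mem_ellisSet_iff_ultrafilter {f : X → X} : f ∈ ellisSet σ ↔
    ∃ U : Ultrafilter ℤ, ∀ x, Tendsto (fun n : ℤ => (σ ^ n) x) U (𝓝 (f x)) := by
  constructor
  · intro hf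
    have hne : (comap (fun n : ℤ => (⇑(σ ^ n) : X → X)) (𝓝 f)).NeBot := by
      refine comap_neBot fun t ht => ?_
      obtain ⟨_, hg, n, rfl⟩ := mem_closure_iff_nhds.1 hf t ht
      exact ⟨n, hg⟩
    refine ⟨Ultrafilter.of (comap (fun n : ℤ => (⇑(σ ^ n) : X → X)) (𝓝 f)), ?_⟩
    exact tendsto_pi_nhds.1 (tendsto_comap.mono_left (Ultrafilter.of_le _))
  · rintro ⟨U, hU⟩
    exact mem_closure_of_tendsto (tendsto_pi_nhds.2 hU) (Eventually.of_forall fun n => ⟨n, rfl⟩)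

theorem exists_limit [CompactSpace X] (σ : X ≃ₜ X) (U : Ultrafilter ℤ) :
    ∃ f : X → X, ∀ x, Tendsto (fun n : ℤ => (σ ^ n) x) U (𝓝 (f x)) :=
  ⟨fun x => (U.map fun n : ℤ => (σ ^ n) x).lim, fun _ => Ultrafilter.le_nhds_lim _⟩

theorem ultrafilter_int_cases (U : Ultrafilter ℤ) :
    (∃ n : ℤ, (U : Filter ℤ) = pure n) ∨ ∃ d, (U : Filter ℤ) ≤ dir d := by
  rcases U.le_cofinite_or_eq_pure with h | ⟨n, hn⟩
  · right
    rw [Int.cofinite_eq] at h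
    rcases Ultrafilter.le_sup_iff.1 h with h | h
    · exact ⟨false, h⟩
    · exact ⟨true, h⟩
  · exact Or.inl ⟨n, by rw [hn]; rfl⟩

theorem eventually_eq_of_tendsto_discrete {α Y : Type*} [TopologicalSpace Y] [DiscreteTopology Y]
    {l : Filter α} {f : α → Y} {y : Y} (h : Tendsto f l (𝓝 y)) : ∀ᶠ a in l, f a = y := by
  rwa [nhds_discrete, tendsto_pure] at h

end Ellis

/-! ### Types of limit maps; description of the Ellis semigroup and its kernel. -/

section Types

variable {X : Type} [TopologicalSpace X] {ψ : ZMod 2 → ZMod 2} {e β : ℤ_[2] → ZMod 2}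
  {σ : X ≃ₜ X} {π : X → ℤ_[2]} {v : X → ZMod 2}

/-- The maps of translation `z`, column `d` and row `i`. -/
structure HasType (hM : IsModel e σ π v) (f : X → X) (z : ℤ_[2]) (d : Bool) (i : ZMod 2) : Prop where
  shift : ∀ (n : ℤ) x, f ((σ ^ n) x) = (σ ^ n) (f x)
  twist : ∀ c x, f (hM.twist c x) = hM.twist c (f x)
  proj : ∀ x, π (f x) = π x + z
  col : ∀ x x', π x = 0 → π x' = 0 → v ((σ ^ offset d) x) = v ((σ ^ offset d) x') → f x = f x'
  row : ∀ x, π (f x) = 0 → v (f x) = v ((σ ^ (-1 : ℤ)) (f x)) + i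

theorem IsModel.eventually_sign (hM : IsModel e σ π v) {l : Filter ℤ} {x y : X}
    (h : Tendsto (fun n : ℤ => (σ ^ n) x) l (𝓝 y)) (k : ℤ) :
    ∀ᶠ n in l, v ((σ ^ (k + n)) x) = v ((σ ^ k) y) := by
  have := ((hM.continuous_sign.comp (σ ^ k).continuous).tendsto y).comp h
  refine (eventually_eq_of_tendsto_discrete this).mono fun n hn => ?_
  rw [zpow_add_apply']
  exact hn

theorem shift_eq_of_tendsto {l : Filter ℤ} [l.NeBot] [T2Space X] {f : X → X}
    (h : ∀ x, Tendsto (fun n : ℤ => (σ ^ n) x) l (𝓝 (f x))) (m : ℤ) (x : X) :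
    f ((σ ^ m) x) = (σ ^ m) (f x) := by
  refine tendsto_nhds_unique (h ((σ ^ m) x)) ?_
  refine (((σ ^ m).continuous.tendsto (f x)).comp (h x)).congr fun n => ?_
  simp only [Function.comp, ← zpow_add_apply', add_comm]

/-- Over 0 the half-orbit on side `d` never crosses the gap, so one sign on that side determines all
signs seen as n tends to `d`. If the image lies over 0 then the point lies over -z, and the jump of
the image is the limit of e(n - z), which is `i`. -/
theorem IsModel.hasType_of_tendsto [T2Space X] (hM : IsModel e σ π v) (hβ : IsDigitCocycle ψ e β)
    {l : Filter ℤ} [l.NeBot] {f : X → X} {z : ℤ_[2]} {d : Bool} {i : ZMod 2}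
    (h : ∀ x, Tendsto (fun n : ℤ => (σ ^ n) x) l (𝓝 (f x))) (hd : l ≤ dir d)
    (hz : l ≤ padicFilter z) (hi : ∀ᶠ n : ℤ in l, e (n - z) = i) : HasType hM f z d i := by
  have hproj : ∀ x, π (f x) = π x + z := by
    intro x
    refine tendsto_nhds_unique ((hM.continuous_proj.tendsto _).comp (h x)) ?_
    refine (((tendsto_padicFilter z).mono_left hz).const_add (π x)).congr fun n => ?_
    simp only [Function.comp, hM.proj_zpow]
  refine ⟨shift_eq_of_tendsto h, fun c x => ?_, hproj, fun x x' hx hx' hv => ?_, fun x hx => ?_⟩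
  · refine hM.ext _ _ (by simp only [hproj, hM.proj_twist]) fun k => ?_
    obtain ⟨n, h1, h2⟩ :=
      ((hM.eventually_sign (h (hM.twist c x)) k).and (hM.eventually_sign (h x) k)).exists
    rw [← h1, hM.sign_twist, hM.sign_twist, h2]
  · refine hM.ext _ _ (by rw [hproj, hproj, hx, hx']) fun k => ?_
    have h3 := (dir_tendsto_add d k).eventually
      (hM.sign_eq_of_side hβ (Or.inl hx) (by rw [hx, hx']) hv)
    obtain ⟨n, h1, h2, h3⟩ := ((hM.eventually_sign (h x) k).and
      ((hM.eventually_sign (h x') k).and (h3.filter_mono hd))).exists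
    rw [← h1, ← h2, add_comm k, h3]
  · have hxz : π x = -z := by rw [hproj] at hx; linear_combination hx
    obtain ⟨n, h1, h2, h3, h4⟩ := ((hM.eventually_sign (h x) 0).and
      ((hM.eventually_sign (h x) (-1)).and (hi.and ((dir_add_ne_zero d (-z)).filter_mono hd)))).exists
    have h5 := hM.sign_zpow_step n x (by rw [hxz]; exact h4)
    rw [zero_add, zpow_zero] at h1
    rw [← h2, show (-1 + n : ℤ) = n - 1 by ring, ← h3]
    have h6 : v (f x) = v ((σ ^ n) x) := h1.symm
    rw [h6, h5, hxz]; congr 2; ring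

theorem IsModel.exists_hasType [T2Space X] [CompactSpace X] (hM : IsModel e σ π v)
    (hβ : IsDigitCocycle ψ e β) (z : ℤ_[2]) (d : Bool) (i : ZMod 2) :
    ∃ f ∈ ellisSet σ, HasType hM f z d i := by
  have hne : (dir d ⊓ padicFilter z ⊓ 𝓟 {n : ℤ | e (n - z) = i}).NeBot :=
    frequently_mem_iff_neBot.1 (hβ.frequently_eq d z i)
  obtain ⟨f, hf⟩ := exists_limit σ (Ultrafilter.of (dir d ⊓ padicFilter z ⊓ 𝓟 {n : ℤ | e (n - z) = i}))
  have hle := Ultrafilter.of_le (dir d ⊓ padicFilter z ⊓ 𝓟 {n : ℤ | e (n - z) = i})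
  refine ⟨f, mem_ellisSet_iff_ultrafilter.2 ⟨_, hf⟩, hM.hasType_of_tendsto hβ hf
    (hle.trans (inf_le_left.trans inf_le_left)) (hle.trans (inf_le_left.trans inf_le_right)) ?_⟩
  exact le_principal_iff.1 (hle.trans inf_le_right)

/-- An ultrafilter on ℤ is principal or tends to one end. In the latter case compactness of ℤ₂
supplies the translation, and the increment, having two values, is constant along the ultrafilter.
-/
theorem IsModel.zpow_or_hasType [T2Space X] (hM : IsModel e σ π v) (hβ : IsDigitCocycle ψ e β)
    {f : X → X} (hf : f ∈ ellisSet σ) : (∃ n : ℤ, f = ⇑(σ ^ n)) ∨ ∃ z d i, HasType hM f z d i := by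
  obtain ⟨U, hU⟩ := mem_ellisSet_iff_ultrafilter.1 hf
  rcases ultrafilter_int_cases U with ⟨n, hn⟩ | ⟨d, hd⟩
  · left
    refine ⟨n, funext fun x => ?_⟩
    have := hU x
    rw [hn, tendsto_pure_left] at this
    by_contra hne
    exact this {(σ ^ n) x}ᶜ (isOpen_compl_singleton.mem_nhds hne) rfl
  · right
    have hz := Ultrafilter.le_nhds_lim (U.map fun n : ℤ => (n : ℤ_[2]))
    set z := (U.map fun n : ℤ => (n : ℤ_[2])).lim
    have hz' : (U : Filter ℤ) ≤ padicFilter z := tendsto_iff_comap.1 hz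
    have : ∃ i, ∀ᶠ n : ℤ in (U : Filter ℤ), e (n - z) = i := by
      rcases U.em fun n : ℤ => e (n - z) = 0 with h | h
      · exact ⟨0, h⟩
      · exact ⟨1, h.mono fun n hn => (zmod_two_cases _).resolve_left hn⟩
    obtain ⟨i, hi⟩ := this
    exact ⟨z, d, i, hM.hasType_of_tendsto hβ hU hd hz' hi⟩

/-- The map applied first decides which side is read, the one applied last which jump is written:
the rectangular band structure of the kernel. -/
theorem HasType.comp {hM : IsModel e σ π v} {f g : X → X} {z z' : ℤ_[2]} {d d' : Bool}
    {i i' : ZMod 2} (hf : HasType hM f z d i) (hg : HasType hM g z' d' i') :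
    HasType hM (f ∘ g) (z' + z) d' i where
  shift n x := by simp only [Function.comp, hg.shift, hf.shift]
  twist c x := by simp only [Function.comp, hg.twist, hf.twist]
  proj x := by simp only [Function.comp, hg.proj, hf.proj, add_assoc]
  col x x' hx hx' hv := congrArg f (hg.col x x' hx hx' hv)
  row x hx := hf.row (g x) hx

theorem HasType.comp_zpow {hM : IsModel e σ π v} {f : X → X} {z : ℤ_[2]} {d : Bool}
    {i : ZMod 2} (hf : HasType hM f z d i) (m : ℤ) :
    HasType hM (f ∘ ⇑(σ ^ m)) (m + z) d i where
  shift n x := by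
    simp only [Function.comp]
    rw [← hf.shift, ← zpow_add_apply', ← zpow_add_apply', add_comm]
  twist c x := by simp only [Function.comp, hM.zpow_twist, hf.twist]
  proj x := by simp only [Function.comp, hf.proj, hM.proj_zpow, add_assoc]
  col x x' hx hx' hv := by simp only [Function.comp, hf.shift, hf.col x x' hx hx' hv]
  row x hx := hf.row _ hx

theorem HasType.zpow_comp {hM : IsModel e σ π v} {f : X → X} {z : ℤ_[2]} {d : Bool}
    {i : ZMod 2} (hf : HasType hM f z d i) (m : ℤ) :
    HasType hM (⇑(σ ^ m) ∘ f) (m + z) d i := by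
  have : ⇑(σ ^ m) ∘ f = f ∘ ⇑(σ ^ m) := funext fun x => (hf.shift m x).symm
  rw [this]
  exact hf.comp_zpow m

theorem HasType.eq_of_admissible {hM : IsModel e σ π v} {f : X → X} {z : ℤ_[2]} {d : Bool}
    {i : ZMod 2} (hf : HasType hM f z d i) {x x' : X} (hx : IsAdmissible (π x)) (hxx : π x = π x')
    (hv : v ((σ ^ offset d) x) = v ((σ ^ offset d) x')) : f x = f x' := by
  rcases hx with hx | hx
  · exact hf.col x x' hx (hxx ▸ hx) hv
  · rw [hM.eq_of_sign_eq hx hxx hv]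

/-- All sign functions on the set of orbits are realised by limits of translation `0`. -/
theorem IsModel.exists_sign [T2Space X] [CompactSpace X] (hM : IsModel e σ π v)
    (hβ : IsDigitCocycle ψ e β) {r : ℤ_[2] → ℤ_[2]} (hr : ∀ y, ∀ n : ℤ, r (y + n) = r y)
    (hr0 : ∀ y, IsAdmissible (r y)) (d : Bool) (s : ℤ_[2] → ZMod 2) :
    ∃ h ∈ ellisSet σ, ∃ i, HasType hM h 0 d i ∧ ∀ x, r (π x) = π x →
      v ((σ ^ offset d) (h x)) = v ((σ ^ offset d) x) + s (π x) := by
  classical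
  let κ := {y : ℤ_[2] // r y = y}
  let P : κ → ℤ → Prop := fun y n =>
    β (y.1 + (offset d : ℤ) + n) = β (y.1 + (offset d : ℤ)) + s y.1
  let L : Finset κ → Filter ℤ := fun F => dir d ⊓ padicFilter 0 ⊓ 𝓟 {n | ∀ y ∈ F, P y n}
  have hanti : Antitone L := fun F G hFG =>
    inf_le_inf_left _ (principal_mono.2 fun n hn y hy => hn y (hFG hy))
  have hadm : ∀ y : κ, IsAdmissible y.1 := fun y => y.2 ▸ hr0 y.1
  have hL : ∀ F, (L F).NeBot := by
    intro F
    refine frequently_mem_iff_neBot.1 ?_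
    have := hβ.frequently_sign d (ι := F) (y := fun y => y.1.1 + (offset d : ℤ)) (fun y y' n hn => by
      have h1 : y.1.1 = y'.1.1 + n := by linear_combination hn
      have h2 := hr y'.1.1 n
      rw [← h1, y.1.2, y'.1.2] at h2
      exact Subtype.ext (Subtype.ext h2)) (fun y j hj => (hadm y.1).side d j hj) (fun y => s y.1.1)
    exact this.mono fun n hn y hy => hn ⟨y, hy⟩
  -- Each finite set of orbits is handled by `IsDigitCocycle.frequently_sign`; directedness then
  -- treats all orbits at once.
  have hne : (⨅ F, L F).NeBot := iInf_neBot_of_directed' hanti.directed_ge hL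
  obtain ⟨h, hh⟩ := exists_limit σ (Ultrafilter.of (⨅ F, L F))
  have hle := Ultrafilter.of_le (⨅ F, L F)
  have hle0 : (Ultrafilter.of (⨅ F, L F) : Filter ℤ) ≤ dir d ⊓ padicFilter 0 :=
    hle.trans ((iInf_le L ∅).trans inf_le_left)
  have hmem : h ∈ ellisSet σ := mem_ellisSet_iff_ultrafilter.2 ⟨_, hh⟩
  have : ∃ i, ∀ᶠ n : ℤ in (Ultrafilter.of (⨅ F, L F) : Filter ℤ), e (n - 0) = i := by
    rcases (Ultrafilter.of (⨅ F, L F)).em fun n : ℤ => e (n - 0) = 0 with h | h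
    · exact ⟨0, h⟩
    · exact ⟨1, h.mono fun n hn => (zmod_two_cases _).resolve_left hn⟩
  obtain ⟨i, hi⟩ := this
  refine ⟨h, hmem, i, hM.hasType_of_tendsto hβ hh (hle0.trans inf_le_left)
    (hle0.trans inf_le_right) hi, fun x hx => ?_⟩
  have hP : ∀ᶠ n : ℤ in (Ultrafilter.of (⨅ F, L F) : Filter ℤ), P ⟨π x, hx⟩ n := by
    have : {n | ∀ y ∈ ({⟨π x, hx⟩} : Finset κ), P y n} ∈ (Ultrafilter.of (⨅ F, L F) : Filter ℤ) :=
      le_principal_iff.1 (hle.trans ((iInf_le L {⟨π x, hx⟩}).trans inf_le_right))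
    filter_upwards [this] with n hn
    exact hn _ (Finset.mem_singleton_self _)
  obtain ⟨n, h1, h2, h3⟩ := ((hM.eventually_sign (hh x) (offset d)).and
    (hP.and ((dir_eventually_side d).filter_mono (hle0.trans inf_le_left)))).exists
  rw [← h1, hM.sign_side hβ (hadm ⟨π x, hx⟩) h3]
  have h4 : β (π x + (offset d : ℤ) + n) = β (π x + (offset d : ℤ)) + s (π x) := h2
  rw [h4]; ring

/-- Two maps of the same type differ by a limit of translation `0`. -/
theorem IsModel.exists_eq_comp [T2Space X] [CompactSpace X] (hM : IsModel e σ π v)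
    (hβ : IsDigitCocycle ψ e β) {f g : X → X} {z : ℤ_[2]} {d : Bool} {i : ZMod 2}
    (hf : HasType hM f z d i) (hg : HasType hM g z d i) : ∃ h ∈ ellisSet σ, f = g ∘ h := by
  obtain ⟨r, hr1, hr2, hr3⟩ := exists_orbit_representative
  have hjump : ∀ {p : X → X}, HasType hM p z d i → ∀ (x : X) (k : ℤ), π (p x) + k = 0 →
      v ((σ ^ k) (p x)) - v ((σ ^ (k - 1)) (p x)) = i := by
    intro p hp x k hk
    have := hp.row ((σ ^ k) x) (by rw [hp.shift, hM.proj_zpow, hk])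
    rw [hp.shift, ← zpow_add_apply', show -1 + k = k - 1 by ring] at this
    rw [this]; ring
  -- Equal translations and equal rows give images over the same base point with the same jump,
  -- hence twists of each other.
  have hfg : ∀ x, ∃ c, f x = hM.twist c (g x) := fun x =>
    hM.exists_eq_twist (by rw [hf.proj, hg.proj]) fun k hk => by
      rw [hjump hf x k hk, hjump hg x k (by rw [← hk, hf.proj, hg.proj])]
  choose b hb using hM.exists_proj_eq hβ
  choose s hs using fun y => hfg (b y)
  -- The twist depends on the base point only, because both maps see just the sign on side `d` and
  -- commute with twists.
  have hfs : ∀ x, IsAdmissible (π x) → f x = hM.twist (s (π x)) (g x) := by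
    intro x hx
    set c := v ((σ ^ offset d) x) - v ((σ ^ offset d) (b (π x))) with hc
    have h1 : π x = π (hM.twist c (b (π x))) := by rw [hM.proj_twist, hb]
    have h2 : v ((σ ^ offset d) x) = v ((σ ^ offset d) (hM.twist c (b (π x)))) := by
      rw [hM.sign_twist, hc]; ring
    rw [hf.eq_of_admissible hx h1 h2, hg.eq_of_admissible hx h1 h2, hf.twist, hg.twist, hs,
      hM.twist_twist, hM.twist_twist, add_comm]
  obtain ⟨h, hh, i', hht, hhs⟩ := hM.exists_sign hβ hr2 hr3 d s
  refine ⟨h, hh, funext fun x => ?_⟩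
  -- Over a representative, `h x` and the required twist of `x` have the same sign on side `d`,
  -- which is all that `g` reads. Commutation with the shift then covers the whole orbit.
  have hrep : ∀ x, r (π x) = π x → f x = g (h x) := by
    intro x hx
    have hadm : IsAdmissible (π x) := hx ▸ hr3 (π x)
    rw [hfs x hadm, ← hg.twist]
    refine hg.eq_of_admissible (by rwa [hM.proj_twist]) ?_ ?_
    · rw [hM.proj_twist, hht.proj, add_zero]
    · rw [hM.sign_twist, hhs x hx]
  obtain ⟨n, hn⟩ := hr1 (π x)
  obtain ⟨x0, rfl⟩ : ∃ x0, x = (σ ^ n) x0 :=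
    ⟨(σ ^ (-n)) x, by rw [← zpow_add_apply', add_neg_cancel, zpow_zero]; rfl⟩
  have hx0 : r (π x0) = π x0 := by
    rw [hM.proj_zpow] at hn
    rw [hr2] at hn
    exact (add_right_cancel hn).symm
  rw [Function.comp, hf.shift, hht.shift, hg.shift, hrep x0 hx0]

/-- Converse of `IsModel.zpow_or_hasType`: every type occurs among limits, and two maps of one type
differ by a right factor from the semigroup. -/
theorem IsModel.mem_ellisSet_of_hasType [T2Space X] [CompactSpace X] (hM : IsModel e σ π v)
    (hβ : IsDigitCocycle ψ e β) {f : X → X} {z : ℤ_[2]} {d : Bool} {i : ZMod 2}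
    (hf : HasType hM f z d i) : f ∈ ellisSet σ := by
  obtain ⟨g, hg, hgt⟩ := hM.exists_hasType hβ z d i
  obtain ⟨h, hh, rfl⟩ := hM.exists_eq_comp hβ hf hgt
  exact comp_mem_ellisSet σ hg hh

/-- The kernel of the Ellis semigroup consists of the maps which have a type. -/
theorem IsModel.mem_semigroupKernel_iff [T2Space X] [CompactSpace X] (hM : IsModel e σ π v)
    (hβ : IsDigitCocycle ψ e β) (f : EllisSemigroup σ) :
    f ∈ semigroupKernel (EllisSemigroup σ) ↔ ∃ z d i, HasType hM f.1 z d i := by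
  constructor
  · intro hf
    refine hf {f : EllisSemigroup σ | ∃ z d i, HasType hM f.1 z d i} ⟨?_, ?_, ?_⟩
    · obtain ⟨f, hf, hft⟩ := hM.exists_hasType hβ 0 true 0
      exact ⟨⟨f, hf⟩, 0, true, 0, hft⟩
    · rintro s x ⟨z, d, i, hx⟩
      rcases hM.zpow_or_hasType hβ s.2 with ⟨n, hn⟩ | ⟨z', d', i', hs⟩
      · refine ⟨n + z, d, i, ?_⟩
        change HasType hM (s.1 ∘ x.1) _ _ _
        rw [hn]
        exact hx.zpow_comp n
      · exact ⟨_, _, _, hs.comp hx⟩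
    · rintro s x ⟨z, d, i, hx⟩
      rcases hM.zpow_or_hasType hβ s.2 with ⟨n, hn⟩ | ⟨z', d', i', hs⟩
      · refine ⟨n + z, d, i, ?_⟩
        change HasType hM (x.1 ∘ s.1) _ _ _
        rw [hn]
        exact hx.comp_zpow n
      · exact ⟨_, _, _, hx.comp hs⟩
  · rintro ⟨z, d, i, hf⟩ I hI
    -- From any `j` in the ideal, a left factor sets the row and a right factor sets the column and
    -- corrects the translation. The product has the type of `f`, and one more right factor turns it
    -- into `f`.
    obtain ⟨j, hj⟩ := hI.nonempty
    obtain ⟨a, ha, hat⟩ := hM.exists_hasType hβ 0 true i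
    have haj : ∃ z' d', HasType hM (a ∘ j.1) z' d' i := by
      rcases hM.zpow_or_hasType hβ j.2 with ⟨n, hn⟩ | ⟨z', d', i', hs⟩
      · rw [hn]; exact ⟨_, _, hat.comp_zpow n⟩
      · exact ⟨_, _, hat.comp hs⟩
    obtain ⟨z', d', hajt⟩ := haj
    obtain ⟨b, hb, hbt⟩ := hM.exists_hasType hβ (z - z') d 0
    have habt := hajt.comp hbt
    rw [sub_add_cancel] at habt
    obtain ⟨h, hh, hfh⟩ := hM.exists_eq_comp hβ hf habt
    have hI' : (⟨a, ha⟩ : EllisSemigroup σ) * j * ⟨b, hb⟩ * ⟨h, hh⟩ ∈ I :=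
      hI.mul_mem_right _ _ (hI.mul_mem_right _ _ (hI.mul_mem_left _ _ hj))
    have : f = (⟨a, ha⟩ : EllisSemigroup σ) * j * ⟨b, hb⟩ * ⟨h, hh⟩ := Subtype.ext hfh
    rwa [this]

end Types

/-! ### The maximal equicontinuous factor -/

section Odometer

theorem isEquicontinuousSystem_odometer : IsEquicontinuousSystem odometer := by
  refine UniformEquicontinuous.equicontinuous
    (Metric.uniformEquicontinuous_of_continuity_modulus id tendsto_id _ fun x y n => ?_)
  rw [odometer_zpow, odometer_zpow, dist_add_right]
  rfl

end Odometer

section Factors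

variable {X Y Z : Type}

/-- In an equicontinuous system, points with a common limit are equal. -/
theorem IsEquicontinuousSystem.eq_of_tendsto [UniformSpace Z] [CompactSpace Z] [T2Space Z]
    {ζ : Z ≃ₜ Z} (h : IsEquicontinuousSystem ζ) {l : Filter ℤ} [l.NeBot] {a b p : Z}
    (ha : Tendsto (fun n : ℤ => (ζ ^ n) a) l (𝓝 p)) (hb : Tendsto (fun n : ℤ => (ζ ^ n) b) l (𝓝 p)) :
    a = b := by
  have hu := CompactSpace.uniformEquicontinuous_of_equicontinuous h
  refine eq_of_uniformity fun {V} hV => ?_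
  have h1 := hu V hV
  have h2 : Tendsto (fun n : ℤ => ((ζ ^ n) a, (ζ ^ n) b)) l (𝓤 Z) :=
    (ha.prodMk_nhds hb).mono_right (nhds_le_uniformity p)
  obtain ⟨n, hn⟩ := (h2.eventually h1).exists
  have := hn (-n)
  simp only [← zpow_add_apply', neg_add_cancel, zpow_zero] at this
  exact this

/-- Maximal equicontinuous factors are unique. -/
theorem IsMaximalEquicontinuousFactor.exists_homeomorph [TopologicalSpace X]
    [UniformSpace Y] [CompactSpace Y] [T2Space Y] [UniformSpace Z] [CompactSpace Z] [T2Space Z]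
    {σ : X ≃ₜ X} {δ : Y ≃ₜ Y} {ζ : Z ≃ₜ Z} {π : X → Y} {ρ : X → Z}
    (h : IsMaximalEquicontinuousFactor σ δ π) (h' : IsMaximalEquicontinuousFactor σ ζ ρ) :
    ∃ g : Y ≃ₜ Z, (∀ y, g (δ y) = ζ (g y)) ∧ ∀ x, ρ x = g (π x) := by
  obtain ⟨f, hf, hfπ⟩ := h.maximal Z ζ ρ h'.factor h'.equicontinuous
  obtain ⟨g, hg, hgρ⟩ := h'.maximal Y δ π h.factor h.equicontinuous
  have h1 : ∀ x, ρ x = f (π x) := congrFun hfπ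
  have h2 : ∀ x, π x = g (ρ x) := congrFun hgρ
  refine ⟨⟨⟨f, g, fun y => ?_, fun z => ?_⟩, hf.continuous, hg.continuous⟩, hf.equivariant, h1⟩
  · obtain ⟨x, rfl⟩ := h.factor.surjective y
    rw [← h1, ← h2]
  · obtain ⟨x, rfl⟩ := h'.factor.surjective z
    rw [← h2, ← h1]

end Factors

/-! ### The odometer as maximal equicontinuous factor, and the singular points. -/

section ModelFactor

variable {X : Type} [TopologicalSpace X] {ψ : ZMod 2 → ZMod 2} {e β : ℤ_[2] → ZMod 2}
  {σ : X ≃ₜ X} {π : X → ℤ_[2]} {v : X → ZMod 2}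

/-- Two points over `0` can be glued at `0`. -/
theorem IsModel.exists_glue (hM : IsModel e σ π v) {p q : X} (hp : π p = 0) (hq : π q = 0) :
    ∃ x, π x = 0 ∧ v x = v p ∧ v ((σ ^ (-1 : ℤ)) x) = v ((σ ^ (-1 : ℤ)) q) := by
  obtain ⟨x, hx, hxs⟩ := hM.exists_point 0
    (fun n => if 0 ≤ n then v ((σ ^ n) p) else v ((σ ^ n) q)) fun n hn => by
      rcases lt_trichotomy n 0 with h | h | h
      · rw [if_neg (by omega), if_neg (by omega)]
        have := hM.sign_zpow_step n q (by rwa [hq])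
        rwa [hq] at this
      · exact absurd (by simp [h]) hn
      · rw [if_pos (by omega), if_pos (by omega)]
        have := hM.sign_zpow_step n p (by rwa [hp])
        rwa [hp] at this
  refine ⟨x, hx, ?_, ?_⟩
  · simpa using hxs 0
  · simpa using hxs (-1)

/-- An equicontinuous factor identifies points whose images under a limit map it identifies. Over 0,
limits towards either end merge points agreeing on that side, and any two points are linked by one
agreeing with each on one side. Every other fibre is brought over 0 by a limit map. -/
theorem IsModel.isMaximalEquicontinuousFactor [CompactSpace X] [T2Space X]
    (hM : IsModel e σ π v) (hβ : IsDigitCocycle ψ e β) :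
    IsMaximalEquicontinuousFactor σ odometer π where
  factor := ⟨hM.continuous_proj, hM.exists_proj_eq hβ, fun x => by rw [hM.proj_shift]; rfl⟩
  equicontinuous := isEquicontinuousSystem_odometer
  maximal Z _ _ _ ζ ρ hρ hζ := by
    have hlim : ∀ {f : X → X} {x x' : X}, f ∈ ellisSet σ → ρ (f x) = ρ (f x') → ρ x = ρ x' := by
      intro f x x' hf hfx
      obtain ⟨U, hU⟩ := mem_ellisSet_iff_ultrafilter.1 hf
      have h1 : ∀ x, Tendsto (fun n : ℤ => (ζ ^ n) (ρ x)) U (𝓝 (ρ (f x))) := fun x =>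
        ((hρ.continuous.tendsto _).comp (hU x)).congr fun n => semiconj_zpow hρ.equivariant n x
      exact hζ.eq_of_tendsto (h1 x) (hfx ▸ h1 x')
    have hside : ∀ (d : Bool) (x x' : X), π x = 0 → π x' = 0 →
        v ((σ ^ offset d) x) = v ((σ ^ offset d) x') → ρ x = ρ x' := by
      intro d x x' hx hx' hv
      obtain ⟨f, hf, hft⟩ := hM.exists_hasType hβ 0 d 0
      exact hlim hf (congrArg ρ (hft.col x x' hx hx' hv))
    have hzero : ∀ x x', π x = 0 → π x' = 0 → ρ x = ρ x' := by
      intro x x' hx hx'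
      obtain ⟨q, hq, hq1, hq2⟩ := hM.exists_glue hx hx'
      exact (hside true x q hx hq (by simpa [offset] using hq1.symm)).trans
        (hside false q x' hq hx' (by simpa [offset] using hq2))
    have hall : ∀ x x', π x = π x' → ρ x = ρ x' := by
      intro x x' hxx
      obtain ⟨f, hf, hft⟩ := hM.exists_hasType hβ (-π x) true 0
      refine hlim hf (hzero _ _ ?_ ?_)
      · rw [hft.proj, add_neg_cancel]
      · rw [hft.proj, ← hxx, add_neg_cancel]
    choose b hb using hM.exists_proj_eq hβ
    have hρb : ρ = (ρ ∘ b) ∘ π := funext fun x => hall _ _ (hb _).symm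
    have hquot : Topology.IsQuotientMap π :=
      hM.continuous_proj.isClosedMap.isQuotientMap hM.continuous_proj (hM.exists_proj_eq hβ)
    refine ⟨ρ ∘ b, ⟨?_, fun z => ?_, fun y => ?_⟩, hρb⟩
    · rw [hquot.continuous_iff, ← hρb]
      exact hρ.continuous
    · obtain ⟨x, rfl⟩ := hρ.surjective z
      exact ⟨π x, (congrFun hρb x).symm⟩
    · have h1 : ρ (σ (b y)) = ζ (ρ (b y)) := hρ.equivariant (b y)
      rw [Function.comp, Function.comp, ← h1]
      exact hall _ _ (by rw [hb, hM.proj_shift, hb]; rfl)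

theorem IsModel.isProximalPair [CompactSpace X] [T2Space X] (hM : IsModel e σ π v)
    (hβ : IsDigitCocycle ψ e β) {d : Bool} {x x' : X} (hx : π x = 0) (hx' : π x' = 0)
    (hv : v ((σ ^ offset d) x) = v ((σ ^ offset d) x')) (m : ℤ) :
    IsProximalPair σ ((σ ^ m) x) ((σ ^ m) x') := by
  intro U hU
  obtain ⟨f, hf, hft⟩ := hM.exists_hasType hβ 0 d 0
  obtain ⟨V, hV⟩ := mem_ellisSet_iff_ultrafilter.1 hf
  have h1 := hV ((σ ^ m) x)
  have h2 := hV ((σ ^ m) x')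
  rw [hft.shift] at h1 h2
  rw [← hft.col x x' hx hx' hv] at h2
  have h3 := h1.prodMk_nhds h2
  exact (h3.eventually (mem_nhdsSet_iff_forall.1 hU _ rfl)).exists

/-- Over a non-integer two distinct points have opposite signs everywhere, so they stay apart. Over
an integer two points may agree on one side of the gap only, which makes them proximal. -/
theorem IsModel.isSingularPoint_iff [CompactSpace X] [T2Space X] (hM : IsModel e σ π v)
    (hβ : IsDigitCocycle ψ e β) (y : ℤ_[2]) : IsSingularPoint σ π y ↔ ∃ n : ℤ, y = n := by
  constructor
  · rintro ⟨x, x', hx, hx', hne, hprox⟩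
    by_contra! hy
    obtain ⟨c, hc⟩ := hM.exists_eq_twist (hx.trans hx'.symm) fun k hk =>
      absurd (by push_cast; linear_combination hk) (hx ▸ hy (-k))
    have hU : {p : X × X | v p.1 = v p.2} ∈ 𝓝ˢ (Set.diagonal X) := by
      have h1 : IsOpen {p : X × X | v p.1 = v p.2} := by
        have : {p : X × X | v p.1 = v p.2} =
            (fun p : X × X => v p.1 - v p.2) ⁻¹' {0} := by
          ext p; simp [sub_eq_zero]
        rw [this]
        refine (isOpen_discrete _).preimage ?_
        exact (hM.continuous_sign.comp continuous_fst).sub (hM.continuous_sign.comp continuous_snd)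
      rw [h1.mem_nhdsSet]
      rintro ⟨a, b⟩ hab
      exact congrArg v hab
    obtain ⟨n, hn⟩ := hprox _ hU
    have hn' : v ((σ ^ n) x) = v ((σ ^ n) x') := hn
    exact hne (hM.eq_of_sign_eq (fun k => hx ▸ hy k) (hx.trans hx'.symm) hn')
  · rintro ⟨n, rfl⟩
    obtain ⟨p, hp⟩ := hM.exists_proj_eq hβ 0
    obtain ⟨q, hq, hq1, hq2⟩ := hM.exists_glue hp ((hM.proj_twist 1 p).trans hp)
    refine ⟨(σ ^ n) p, (σ ^ n) q, by rw [hM.proj_zpow, hp, zero_add],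
      by rw [hM.proj_zpow, hq, zero_add], fun heq => ?_,
      hM.isProximalPair hβ (d := true) hp hq (by simpa [offset] using hq1.symm) n⟩
    rw [(σ ^ n).injective heq, hM.sign_twist] at hq2
    simp at hq2

end ModelFactor

/-! ### The restricted kernel semigroup -/

section MatrixTwo

/-- The number encoding an element of `S₂`. -/
def permSign (g : Equiv.Perm (Fin 2)) : ZMod 2 := if g = 1 then 0 else 1

/-- The row of an element of `𝓜₂`. -/
def rowSign (i : Fin 2) : ZMod 2 := if i = 0 then 0 else 1

/-- The action of `𝓜₂` on pairs of signs. -/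
def matrixTwoAction (m : MatrixSemigroupM2) (p : ZMod 2 × ZMod 2) : ZMod 2 × ZMod 2 :=
  (permSign m.val + cond (decide (m.col = 1)) p.2 p.1,
    permSign m.val + rowSign m.row + cond (decide (m.col = 1)) p.2 p.1)

/-- The left factor reads an extra row sign of the right factor exactly when it reads the second
coordinate and the right factor has the second row; this is the entry τ of the sandwich matrix. -/
theorem matrixTwoAction_mul (m n : MatrixSemigroupM2) (p : ZMod 2 × ZMod 2) :
    matrixTwoAction (m * n) p = matrixTwoAction m (matrixTwoAction n p) := by
  obtain ⟨i, g, l⟩ := m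
  obtain ⟨j, h, k⟩ := n
  change matrixTwoAction ⟨i, g * _ * h, k⟩ p = _
  revert i g l j h k p
  decide

theorem matrixTwoAction_injective {m n : MatrixSemigroupM2}
    (h : ∀ p, matrixTwoAction m p = matrixTwoAction n p) : m = n := by
  obtain ⟨i, g, l⟩ := m
  obtain ⟨j, g', k⟩ := n
  have : ∀ i g l j h k, (∀ p, matrixTwoAction ⟨i, g, l⟩ p = matrixTwoAction ⟨j, h, k⟩ p) →
      i = j ∧ g = h ∧ l = k := by decide
  obtain ⟨rfl, rfl, rfl⟩ := this i g l j g' k h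
  rfl

theorem exists_matrixTwo (d : Bool) (g i : ZMod 2) : ∃ m : MatrixSemigroupM2,
    permSign m.val = g ∧ rowSign m.row = i ∧ decide (m.col = 1) = d := by
  have h1 : ∀ g, ∃ p, permSign p = g := by decide
  have h2 : ∀ i, ∃ r, rowSign r = i := by decide
  have h3 : ∀ d : Bool, ∃ c : Fin 2, decide (c = 1) = d := by decide
  obtain ⟨p, hp⟩ := h1 g
  obtain ⟨r, hr⟩ := h2 i
  obtain ⟨c, hc⟩ := h3 d
  exact ⟨⟨r, p, c⟩, hp, hr, hc⟩

theorem card_matrixSemigroupM2 : Nat.card MatrixSemigroupM2 = 8 := by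
  let E : MatrixSemigroupM2 ≃ Fin 2 × Equiv.Perm (Fin 2) × Fin 2 :=
    { toFun := fun m => (m.row, m.val, m.col)
      invFun := fun p => ⟨p.1, p.2.1, p.2.2⟩
      left_inv := fun _ => rfl
      right_inv := fun _ => rfl }
  rw [Nat.card_congr E, Nat.card_prod, Nat.card_prod, Nat.card_eq_fintype_card,
    Nat.card_eq_fintype_card, Fintype.card_perm, Fintype.card_fin]
  rfl

end MatrixTwo

/-! ### The kernel acting on a singular fibre through pairs of signs. -/

section KernelFibre

variable {X : Type} [TopologicalSpace X] {ψ : ZMod 2 → ZMod 2} {e β : ℤ_[2] → ZMod 2}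
  {σ : X ≃ₜ X} {π : X → ℤ_[2]} {v : X → ZMod 2}

/-- The signs on both sides of `0` of a point over `n`. -/
def sidePair (σ : X ≃ₜ X) (v : X → ZMod 2) (n : ℤ) (x : X) : ZMod 2 × ZMod 2 :=
  (v ((σ ^ (-1 : ℤ)) ((σ ^ (-n)) x)), v ((σ ^ (-n)) x))

theorem IsModel.ext_zero (hM : IsModel e σ π v) (hβ : IsDigitCocycle ψ e β) {x x' : X}
    (hx : π x = 0) (hx' : π x' = 0) (h0 : v x = v x')
    (h1 : v ((σ ^ (-1 : ℤ)) x) = v ((σ ^ (-1 : ℤ)) x')) : x = x' := by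
  refine hM.ext _ _ (hx.trans hx'.symm) fun n => ?_
  have key : ∀ d, v ((σ ^ offset d) x) = v ((σ ^ offset d) x') →
      ∀ m : ℤ, cond d (0 ≤ m) (m ≤ 0) →
        v ((σ ^ (offset d + m)) x) = v ((σ ^ (offset d + m)) x') := by
    intro d hd m hm
    rw [hM.sign_side hβ (Or.inl hx) hm, hM.sign_side hβ (Or.inl hx') hm, hd, hx, hx']
  rcases le_or_gt 0 n with h | h
  · simpa [offset] using key true (by simpa [offset] using h0) n h
  · have := key false (by simpa [offset] using h1) (n + 1) (by simp; omega)
    simpa [offset] using this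

theorem IsModel.sidePair_injective (hM : IsModel e σ π v) (hβ : IsDigitCocycle ψ e β) {n : ℤ}
    {x x' : X} (hx : π x = n) (hx' : π x' = n) (h : sidePair σ v n x = sidePair σ v n x') :
    x = x' := by
  have h1 : ∀ {x}, π x = n → π ((σ ^ (-n)) x) = 0 := fun hx => by
    rw [hM.proj_zpow, hx]; push_cast; ring
  exact (σ ^ (-n)).injective
    (hM.ext_zero hβ (h1 hx) (h1 hx') (congrArg Prod.snd h) (congrArg Prod.fst h))

theorem IsModel.exists_sidePair (hM : IsModel e σ π v) (hβ : IsDigitCocycle ψ e β) (n : ℤ)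
    (p : ZMod 2 × ZMod 2) : ∃ x, π x = n ∧ sidePair σ v n x = p := by
  obtain ⟨x0, hx0⟩ := hM.exists_proj_eq hβ 0
  have htw : ∀ (m : ℤ) (c : ZMod 2), ∃ x, π x = 0 ∧ v ((σ ^ m) x) = c := fun m c =>
    ⟨hM.twist (c - v ((σ ^ m) x0)) x0, by rw [hM.proj_twist, hx0], by rw [hM.sign_twist]; ring⟩
  obtain ⟨a, ha, ha'⟩ := htw 0 p.2
  obtain ⟨b, hb, hb'⟩ := htw (-1) p.1
  obtain ⟨x, hx, hx1, hx2⟩ := hM.exists_glue ha hb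
  refine ⟨(σ ^ n) x, by rw [hM.proj_zpow, hx, zero_add], ?_⟩
  have : (σ ^ (-n)) ((σ ^ n) x) = x := by
    rw [← zpow_add_apply', neg_add_cancel, zpow_zero]; rfl
  refine Prod.ext ?_ ?_
  · simp only [sidePair]; rw [this, hx2, hb']
  · simp only [sidePair]; rw [this, hx1]; exact ha'

theorem sidePair_cond (σ : X ≃ₜ X) (v : X → ZMod 2) (d : Bool) (n : ℤ) (x : X) :
    v ((σ ^ offset d) ((σ ^ (-n)) x)) = cond d (sidePair σ v n x).2 (sidePair σ v n x).1 := by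
  cases d <;> simp [sidePair, offset]

/-- The image depends only on the sign read on side `d`, and equivariance under twists makes this
dependence additive, leaving one free constant `g`; the row fixes the difference of the two output
signs. -/
theorem HasType.exists_sidePair {hM : IsModel e σ π v} (hβ : IsDigitCocycle ψ e β) {f : X → X}
    {d : Bool} {i : ZMod 2} (hf : HasType hM f 0 d i) (n : ℤ) : ∃ g, ∀ x, π x = n →
      sidePair σ v n (f x) = (g + cond d (sidePair σ v n x).2 (sidePair σ v n x).1,
        g + i + cond d (sidePair σ v n x).2 (sidePair σ v n x).1) := by
  obtain ⟨x0, hx0, _⟩ := hM.exists_sidePair hβ n 0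
  refine ⟨(sidePair σ v n (f x0)).1 - cond d (sidePair σ v n x0).2 (sidePair σ v n x0).1,
    fun x hx => ?_⟩
  have hz : ∀ {x}, π x = n → π ((σ ^ (-n)) x) = 0 := fun hx => by
    rw [hM.proj_zpow, hx]; push_cast; ring
  set c := cond d (sidePair σ v n x).2 (sidePair σ v n x).1 -
    cond d (sidePair σ v n x0).2 (sidePair σ v n x0).1 with hc
  have h1 := hf.col ((σ ^ (-n)) x) (hM.twist c ((σ ^ (-n)) x0)) (hz hx)
    (by rw [hM.proj_twist, hz hx0]) (by
      rw [hM.sign_twist, sidePair_cond σ v, sidePair_cond σ v, hc]; ring)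
  have h2 : v ((σ ^ (-1 : ℤ)) ((σ ^ (-n)) (f x))) =
      v ((σ ^ (-1 : ℤ)) ((σ ^ (-n)) (f x0))) + c := by
    rw [← hf.shift, h1, hf.twist, hM.sign_twist, hf.shift]
  have h3 := hf.row ((σ ^ (-n)) x) (by rw [hf.proj, hz hx, zero_add])
  rw [hf.shift] at h3
  refine Prod.ext ?_ ?_
  · simp only [sidePair] at h2 hc ⊢
    rw [h2, hc]; ring
  · simp only [sidePair] at h2 hc ⊢
    rw [h3, h2, hc]; ring

theorem HasType.twist_comp {hM : IsModel e σ π v} {f : X → X} {z : ℤ_[2]} {d : Bool} {i : ZMod 2}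
    (hf : HasType hM f z d i) (c : ZMod 2) : HasType hM (fun x => hM.twist c (f x)) z d i where
  shift n x := by simp only [hf.shift, hM.zpow_twist]
  twist c' x := by simp only [hf.twist, hM.twist_twist, add_comm]
  proj x := by simp only [hM.proj_twist, hf.proj]
  col x x' hx hx' hv := by simp only [hf.col x x' hx hx' hv]
  row x hx := by
    have h1 := hf.row x (by rwa [hM.proj_twist] at hx)
    have h2 := hM.sign_twist c (f x) 0
    rw [zpow_zero] at h2
    rw [hM.sign_twist]
    have h3 : v (hM.twist c (f x)) = v (f x) + c := h2
    rw [h3, h1]; ring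

theorem IsModel.exists_hasType_sidePair [CompactSpace X] [T2Space X] (hM : IsModel e σ π v)
    (hβ : IsDigitCocycle ψ e β) (n : ℤ) (d : Bool) (i g : ZMod 2) :
    ∃ f ∈ ellisSet σ, HasType hM f 0 d i ∧ ∀ x, π x = n →
      sidePair σ v n (f x) = (g + cond d (sidePair σ v n x).2 (sidePair σ v n x).1,
        g + i + cond d (sidePair σ v n x).2 (sidePair σ v n x).1) := by
  obtain ⟨f, hf, hft⟩ := hM.exists_hasType hβ 0 d i
  obtain ⟨g0, hg0⟩ := hft.exists_sidePair hβ n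
  -- A global twist keeps the type, hence stays in the semigroup, and adjusts the constant to `g`.
  refine ⟨_, hM.mem_ellisSet_of_hasType hβ (hft.twist_comp (g - g0)), hft.twist_comp (g - g0),
    fun x hx => ?_⟩
  have h1 : ∀ y, sidePair σ v n (hM.twist (g - g0) y) =
      ((sidePair σ v n y).1 + (g - g0), (sidePair σ v n y).2 + (g - g0)) := by
    intro y
    have h2 := hM.sign_twist (g - g0) y (-n)
    simp only [sidePair, ← zpow_add_apply', hM.sign_twist]
  rw [h1, hg0 x hx]
  refine Prod.ext ?_ ?_ <;> dsimp only <;> ring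

/-- The restricted kernel semigroup over an integer base point is `𝓜₂`. -/
theorem IsModel.nonempty_mulEquiv [CompactSpace X] [T2Space X] (hM : IsModel e σ π v)
    (hβ : IsDigitCocycle ψ e β) {Y : Type} {ρ : X → Y} (hρ : ∀ x x', ρ x = ρ x' ↔ π x = π x')
    {ξ : Y} {n : ℤ} (hξ : ∀ x, ρ x = ξ ↔ π x = n) :
    Nonempty (kernelFibreSemigroup σ ρ ξ ≃* MatrixSemigroupM2) := by
  have hact : ∀ m : MatrixSemigroupM2, ∃ f : EllisSemigroup σ,
      (f ∈ semigroupKernel (EllisSemigroup σ) ∩ fibrePreserving σ ρ) ∧ ∀ x, π x = n →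
        sidePair σ v n (f.1 x) = matrixTwoAction m (sidePair σ v n x) := by
    intro m
    obtain ⟨f, hf, hft, hfs⟩ := hM.exists_hasType_sidePair hβ n (decide (m.col = 1))
      (rowSign m.row) (permSign m.val)
    exact ⟨⟨f, hf⟩, ⟨(hM.mem_semigroupKernel_iff hβ _).2 ⟨_, _, _, hft⟩, fun x => (hρ _ _).2
      (by rw [hft.proj, add_zero])⟩, hfs⟩
  choose f hf hfs using hact
  let φ : MatrixSemigroupM2 → kernelFibreSemigroup σ ρ ξ := fun m =>
    ⟨fun x => ⟨(f m).1 x.1, ((hf m).2 x.1).trans x.2⟩, f m, hf m, fun _ => rfl⟩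
  have hφ : ∀ m x, ((φ m).1 x).1 = (f m).1 x.1 := fun _ _ => rfl
  have hmem : ∀ x : ↥(ρ ⁻¹' {ξ}), π x.1 = n := fun x => (hξ _).1 x.2
  refine ⟨(MulEquiv.ofBijective (⟨φ, fun m m' => ?_⟩ : MatrixSemigroupM2 →ₙ* _)
    ⟨fun m m' hmm => ?_, fun χ => ?_⟩).symm⟩
  · refine Subtype.ext (funext fun x => Subtype.ext ?_)
    have h1 : ((φ m * φ m').1 x).1 = (f m).1 ((f m').1 x.1) := rfl
    rw [h1, hφ]
    have hx := hmem x
    have hx' : π ((f m').1 x.1) = n := ((hρ _ _).1 ((hf m').2 x.1)).trans hx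
    refine hM.sidePair_injective hβ (((hρ _ _).1 ((hf (m * m')).2 x.1)).trans hx)
      (((hρ _ _).1 ((hf m).2 _)).trans hx') ?_
    rw [hfs _ _ hx, hfs _ _ hx', hfs _ _ hx, matrixTwoAction_mul]
  · refine matrixTwoAction_injective fun p => ?_
    obtain ⟨x, hx, rfl⟩ := hM.exists_sidePair hβ n p
    rw [← hfs m x hx, ← hfs m' x hx]
    have h1 := congrArg (fun χ : kernelFibreSemigroup σ ρ ξ => (χ.1 ⟨x, (hξ x).2 hx⟩).1) hmm
    exact congrArg _ h1
  · obtain ⟨χ, g, ⟨hg1, hg2⟩, hg3⟩ := χ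
    obtain ⟨z, d, i, hgt⟩ := (hM.mem_semigroupKernel_iff hβ _).1 hg1
    obtain ⟨x0, -⟩ := hM.exists_proj_eq hβ 0
    obtain rfl : z = 0 := by
      have h1 := (hρ _ _).1 (hg2 x0)
      rw [hgt.proj] at h1
      simpa using h1
    obtain ⟨c, hc⟩ := hgt.exists_sidePair hβ n
    obtain ⟨m, hm1, hm2, hm3⟩ := exists_matrixTwo d c i
    refine ⟨m, Subtype.ext (funext fun x => Subtype.ext ?_)⟩
    have h1 : ((φ m).1 x).1 = (f m).1 x.1 := rfl
    refine Eq.trans h1 (Eq.trans ?_ (hg3 x).symm)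
    have hx := hmem x
    refine hM.sidePair_injective hβ (((hρ _ _).1 ((hf m).2 x.1)).trans hx)
      (((hρ _ _).1 (hg2 _)).trans hx) ?_
    rw [hfs _ _ hx, hc _ hx, matrixTwoAction, hm1, hm2, hm3]

end KernelFibre

/-! ### Algebraic isomorphisms of Ellis semigroups -/

section Transfer

variable {X X' : Type} [TopologicalSpace X] [TopologicalSpace X']
  {e e' : ℤ_[2] → ZMod 2} {σ : X ≃ₜ X} {π : X → ℤ_[2]} {v : X → ZMod 2}
  {σ' : X' ≃ₜ X'} {π' : X' → ℤ_[2]} {v' : X' → ZMod 2}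

/-- Adding a function of the base point to the signs. -/
structure IsTransfer (σ : X ≃ₜ X) (π : X → ℤ_[2]) (v : X → ZMod 2) (σ' : X' ≃ₜ X')
    (π' : X' → ℤ_[2]) (v' : X' → ZMod 2) (γ : ℤ_[2] → ZMod 2) (H : X → X') : Prop where
  proj : ∀ x, π' (H x) = π x
  sign : ∀ x (n : ℤ), v' ((σ' ^ n) (H x)) = v ((σ ^ n) x) + γ (π x + n)

theorem IsModel.exists_transfer (hM : IsModel e σ π v) (hM' : IsModel e' σ' π' v')
    {γ : ℤ_[2] → ZMod 2} (hγ : ∀ w, γ w = γ (w - 1) + (e' w - e w)) :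
    ∃ H, IsTransfer σ π v σ' π' v' γ H := by
  have : ∀ x, ∃ x', π' x' = π x ∧ ∀ n : ℤ, v' ((σ' ^ n) x') = v ((σ ^ n) x) + γ (π x + n) := by
    intro x
    refine hM'.exists_point (π x) _ fun n hn => ?_
    rw [hM.sign_zpow_step n x hn, hγ (π x + n),
      show π x + ((n - 1 : ℤ) : ℤ_[2]) = π x + n - 1 by push_cast; ring]
    ring
  choose H hH1 hH2 using this
  exact ⟨H, hH1, hH2⟩

variable {γ : ℤ_[2] → ZMod 2} {H : X → X'} {H' : X' → X}

theorem IsTransfer.comp_eq (hM : IsModel e σ π v) (h : IsTransfer σ π v σ' π' v' γ H)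
    (h' : IsTransfer σ' π' v' σ π v (fun w => -γ w) H') (x : X) : H' (H x) = x := by
  refine hM.ext _ _ (by rw [h'.proj, h.proj]) fun n => ?_
  rw [h'.sign, h.sign, h.proj]; ring

theorem IsTransfer.zpow (hM : IsModel e σ π v) (hM' : IsModel e' σ' π' v')
    (h : IsTransfer σ π v σ' π' v' γ H) (n : ℤ) (x : X) : H ((σ ^ n) x) = (σ' ^ n) (H x) := by
  refine hM'.ext _ _ (by rw [h.proj, hM'.proj_zpow, h.proj, hM.proj_zpow]) fun m => ?_
  rw [h.sign, ← zpow_add_apply', ← zpow_add_apply', h.sign, hM.proj_zpow]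
  push_cast
  rw [add_assoc (π x), add_comm (n : ℤ_[2])]

theorem IsTransfer.twist (hM : IsModel e σ π v) (hM' : IsModel e' σ' π' v')
    (h : IsTransfer σ π v σ' π' v' γ H) (c : ZMod 2) (x : X) :
    H (hM.twist c x) = hM'.twist c (H x) := by
  refine hM'.ext _ _ (by rw [h.proj, hM'.proj_twist, h.proj, hM.proj_twist]) fun m => ?_
  rw [h.sign, hM'.sign_twist, h.sign, hM.sign_twist, hM.proj_twist]; ring

/-- The added signs depend on the base point alone, so translation, column and equivariance are
untouched; only the row moves, by the jump of `γ` at 0. Continuity of `H` is never needed. -/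
theorem IsTransfer.hasType {hM : IsModel e σ π v} (hM' : IsModel e' σ' π' v')
    (h : IsTransfer σ π v σ' π' v' γ H) (h' : IsTransfer σ' π' v' σ π v (fun w => -γ w) H')
    {f : X → X} {z : ℤ_[2]} {d : Bool} {i : ZMod 2} (hf : HasType hM f z d i) :
    HasType hM' (H ∘ f ∘ H') z d (i + γ 0 - γ (-1)) where
  shift n x := by
    simp only [Function.comp]
    rw [h'.zpow hM' hM, hf.shift, h.zpow hM hM']
  twist c x := by
    simp only [Function.comp]
    rw [h'.twist hM' hM, hf.twist, h.twist hM hM']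
  proj x := by simp only [Function.comp, h.proj, hf.proj, h'.proj]
  col x x' hx hx' hv := by
    refine congrArg H (hf.col _ _ (by rw [h'.proj, hx]) (by rw [h'.proj, hx']) ?_)
    rw [h'.sign, h'.sign, hv, hx, hx']
  row x hx := by
    simp only [Function.comp, h.proj] at hx ⊢
    have h0 := h.sign (f (H' x)) 0
    rw [zpow_zero, zpow_zero, hx] at h0
    have h1 : v' (H (f (H' x))) = v (f (H' x)) + γ (0 + ((0 : ℤ) : ℤ_[2])) := h0
    rw [h1, h.sign, hf.row _ hx, hx]
    push_cast
    rw [zero_add, zero_add]; ring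

variable {ψ ψ' : ZMod 2 → ZMod 2} {β β' : ℤ_[2] → ZMod 2}

theorem IsTransfer.mem_ellisSet [T2Space X] [CompactSpace X'] [T2Space X']
    (hM : IsModel e σ π v) (hM' : IsModel e' σ' π' v')
    (hβ : IsDigitCocycle ψ e β) (hβ' : IsDigitCocycle ψ' e' β')
    (h : IsTransfer σ π v σ' π' v' γ H) (h' : IsTransfer σ' π' v' σ π v (fun w => -γ w) H')
    {f : X → X} (hf : f ∈ ellisSet σ) : H ∘ f ∘ H' ∈ ellisSet σ' := by
  rcases hM.zpow_or_hasType hβ hf with ⟨n, rfl⟩ | ⟨z, d, i, hft⟩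
  · have : H ∘ ⇑(σ ^ n) ∘ H' = ⇑(σ' ^ n) := by
      funext x
      simp only [Function.comp]
      rw [h.zpow hM hM']
      have hγ : (fun w => - -γ w) = γ := funext fun w => neg_neg _
      rw [IsTransfer.comp_eq hM' h' (H' := H) (by rw [hγ]; exact h)]
    rw [this]
    exact zpow_mem_ellisSet σ' n
  · exact hM'.mem_ellisSet_of_hasType hβ' (h.hasType hM' h' hft)

/-- Models over the odometer have algebraically isomorphic Ellis semigroups. -/
theorem IsModel.exists_bijective_algebraicMorphism [CompactSpace X] [T2Space X] [CompactSpace X']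
    [T2Space X'] (hM : IsModel e σ π v) (hM' : IsModel e' σ' π' v')
    (hβ : IsDigitCocycle ψ e β) (hβ' : IsDigitCocycle ψ' e' β') :
    ∃ Φ : EllisSemigroup σ → EllisSemigroup σ', IsAlgebraicMorphism Φ ∧ Function.Bijective Φ := by
  obtain ⟨γ, hγ⟩ := exists_coboundary fun w => e' w - e w
  obtain ⟨H, h⟩ := hM.exists_transfer hM' hγ
  obtain ⟨H', h'⟩ := hM'.exists_transfer hM (γ := fun w => -γ w) fun w => by
    rw [hγ w]; ring
  have hγ' : IsTransfer σ π v σ' π' v' (fun w => - -γ w) H := by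
    simp only [neg_neg]; exact h
  have hHH : ∀ x, H' (H x) = x := h.comp_eq hM h'
  have hHH' : ∀ x, H (H' x) = x := h'.comp_eq hM' hγ'
  refine ⟨fun f => ⟨H ∘ f.1 ∘ H', h.mem_ellisSet hM hM' hβ hβ' h' f.2⟩, ⟨fun f g => ?_, ?_,
    fun n f => ?_⟩, fun f g hfg => ?_, fun f => ?_⟩
  · refine Subtype.ext (funext fun x => ?_)
    change H (f.1 (g.1 (H' x))) = H (f.1 (H' (H (g.1 (H' x)))))
    rw [hHH]
  · exact Subtype.ext (funext fun x => hHH' x)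
  · refine Subtype.ext (funext fun x => ?_)
    exact h.zpow hM hM' n (f.1 (H' x))
  · refine Subtype.ext (funext fun x => ?_)
    have := congrArg (fun k : EllisSemigroup σ' => H' (k.1 (H x))) hfg
    simpa only [Function.comp, hHH] using this
  · refine ⟨⟨H' ∘ f.1 ∘ H, h'.mem_ellisSet hM' hM hβ' hβ hγ' f.2⟩, Subtype.ext (funext fun x => ?_)⟩
    simp only [Function.comp, hHH']

end Transfer

/-! ### Continuity as the obstruction. -/

section Continuity

variable {X X' : Type} [TopologicalSpace X] [TopologicalSpace X']
  {e e' : ℤ_[2] → ZMod 2} {σ : X ≃ₜ X} {π : X → ℤ_[2]} {v : X → ZMod 2}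
  {σ' : X' ≃ₜ X'} {π' : X' → ℤ_[2]} {v' : X' → ZMod 2}
  {ψ ψ' : ZMod 2 → ZMod 2} {β β' : ℤ_[2] → ZMod 2}

/-- Equivariance and the unit send σⁿ to σ'ⁿ, so a continuous morphism preserves limits along one
and the same filter of integers. -/
theorem IsAlgebraicMorphism.tendsto_apply {Φ : EllisSemigroup σ → EllisSemigroup σ'}
    (hΦ : IsAlgebraicMorphism Φ) (hc : Continuous Φ) {l : Filter ℤ} {f : EllisSemigroup σ}
    (hf : ∀ x, Tendsto (fun n : ℤ => (σ ^ n) x) l (𝓝 (f.1 x))) (x : X') :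
    Tendsto (fun n : ℤ => (σ' ^ n) x) l (𝓝 ((Φ f).1 x)) := by
  have h1 : Tendsto (fun n : ℤ => ellisShift σ n 1) l (𝓝 f) :=
    tendsto_subtype_rng.2 (tendsto_pi_nhds.2 hf)
  have h2 := (hc.tendsto f).comp h1
  have h3 := tendsto_pi_nhds.1 (tendsto_subtype_rng.1 h2) x
  refine h3.congr fun n => ?_
  rw [Function.comp, hΦ.map_shift, hΦ.map_one]
  rfl

/-- The exponents are odd so that, in e(2ᵗ⁺¹ c), the number t = 2k contributes 0 modulo 2. -/
theorem exists_ultrafilter_pow {c : ℤ} (hc : 0 < c) : ∃ U : Ultrafilter ℤ,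
    (U : Filter ℤ) ≤ dir true ∧ (U : Filter ℤ) ≤ padicFilter 0 ∧
      ∀ P : ℤ → Prop, (∀ k : ℕ, P (2 ^ (2 * k + 1) * c)) → ∀ᶠ n in (U : Filter ℤ), P n := by
  let u : ℕ → ℤ := fun k => 2 ^ (2 * k + 1) * c
  refine ⟨Ultrafilter.of (map u atTop), (Ultrafilter.of_le _).trans ?_,
    (Ultrafilter.of_le _).trans ?_, fun P hP => ?_⟩
  · refine tendsto_atTop_mono (fun k => ?_) tendsto_natCast_atTop_atTop
    have h1 : (k : ℤ) < 2 ^ k := by exact_mod_cast Nat.lt_two_pow_self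
    have h2 : (2 : ℤ) ^ k ≤ 2 ^ (2 * k + 1) := pow_le_pow_right₀ (by norm_num) (by omega)
    have h3 : (2 : ℤ) ^ (2 * k + 1) ≤ u k := le_mul_of_one_le_right (by positivity) hc
    exact (h1.le.trans h2).trans h3
  · intro V hV
    obtain ⟨m, hm⟩ := mem_padicFilter.1 hV
    refine mem_map.2 ?_
    filter_upwards [eventually_ge_atTop m] with k hk
    refine hm _ ?_
    simp only [u]
    push_cast
    rw [sub_zero]
    exact Dvd.dvd.mul_right (pow_dvd_pow 2 (by omega)) _
  · exact Ultrafilter.of_le _ (mem_map.2 (Eventually.of_forall hP))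

/-- Models with different values `ψ 0` have no continuous algebraic morphism between their
Ellis semigroups. -/
theorem IsModel.not_continuous [CompactSpace X] [T2Space X] [T2Space X']
    (hM : IsModel e σ π v) (hM' : IsModel e' σ' π' v')
    (hβ : IsDigitCocycle ψ e β) (hβ' : IsDigitCocycle ψ' e' β') (hψ : ψ 0 = 1) (hψ' : ψ' 0 = 0)
    {Φ : EllisSemigroup σ → EllisSemigroup σ'} (hΦ : IsAlgebraicMorphism Φ) : ¬ Continuous Φ := by
  intro hc
  have htwo : ∀ k : ℕ, ((2 * k : ℕ) : ZMod 2) = 0 := fun k => by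
    push_cast; rw [two_mul]; exact zmod_two_add_self _
  have key : ∀ c : ℤ, 0 < c → ∀ i, (∀ k : ℕ, e (2 ^ (2 * k + 1) * c) = 0) →
      (∀ k : ℕ, e' (2 ^ (2 * k + 1) * c) = i) →
      ∃ f : EllisSemigroup σ, HasType hM f.1 0 true 0 ∧ HasType hM' (Φ f).1 0 true i := by
    intro c hc0 i h0 hi
    obtain ⟨U, hU1, hU2, hU3⟩ := exists_ultrafilter_pow hc0
    obtain ⟨f, hf⟩ := exists_limit σ U
    refine ⟨⟨f, mem_ellisSet_iff_ultrafilter.2 ⟨U, hf⟩⟩,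
      hM.hasType_of_tendsto hβ hf hU1 hU2 (hU3 _ fun k => ?_),
      hM'.hasType_of_tendsto hβ' (hΦ.tendsto_apply hc hf) hU1 hU2 (hU3 _ fun k => ?_)⟩
    · rw [← h0 k]; congr 1; push_cast; ring
    · rw [← hi k]; congr 1; push_cast; ring
  obtain ⟨f, hf, hΦf⟩ := key 1 one_pos 0 (fun k => by
    have := hβ.pow_mul_one_add (2 * k) 0
    simpa [htwo] using this) (fun k => by
    have := hβ'.pow_mul_one_add (2 * k) 0
    rw [htwo] at this
    simpa using this)
  -- The factor 3 replaces `t` by 1 - ψ 0 + t: no change in the source, where ψ 0 = 1, but a change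
  -- of row in the target, where ψ' 0 = 0.
  obtain ⟨g, hg, hΦg⟩ := key 3 (by norm_num) 1 (fun k => by
    have := hβ.pow_mul_three_add (2 * k) 0
    rw [htwo, hψ] at this
    simpa using this) (fun k => by
    have := hβ'.pow_mul_three_add (2 * k) 0
    rw [htwo, hψ'] at this
    simpa using this)
  -- As `f` and `g` have one type, g = f h. The outer factor decides the row, so the images of `f`
  -- and `g` share their row, although these are 0 and 1.
  obtain ⟨h, hh, hgh⟩ := hM.exists_eq_comp hβ hg hf
  have hmul : g = f * ⟨h, hh⟩ := Subtype.ext hgh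
  obtain ⟨x, hx⟩ := hM'.exists_proj_eq hβ' 0
  have h1 := hΦg.row x (by rw [hΦg.proj, hx, zero_add])
  have h2 : (Φ g).1 x = (Φ f).1 ((Φ ⟨h, hh⟩).1 x) := by
    rw [hmul, hΦ.map_mul]; rfl
  have h3 := hΦf.row ((Φ ⟨h, hh⟩).1 x) (by rw [← h2, hΦg.proj, hx, zero_add])
  rw [← h2] at h3
  rw [h3] at h1
  simp at h1

/-- A conjugacy induces a continuous algebraic isomorphism of the Ellis semigroups. -/
theorem AreConjugate.exists_continuous (h : AreConjugate σ σ') :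
    ∃ Φ : EllisSemigroup σ → EllisSemigroup σ', IsAlgebraicMorphism Φ ∧ Continuous Φ := by
  obtain ⟨g, hg⟩ := h
  have hconj : Continuous fun f : X → X => (g ∘ f ∘ g.symm : X' → X') :=
    continuous_pi fun x => g.continuous.comp (continuous_apply (g.symm x))
  have hz : ∀ (n : ℤ) x, g ((σ ^ n) x) = (σ' ^ n) (g x) := semiconj_zpow hg
  have hmem : ∀ f ∈ ellisSet σ, (g ∘ f ∘ g.symm : X' → X') ∈ ellisSet σ' := by
    intro f hf
    refine map_mem_closure (f := fun f : X → X => (g ∘ f ∘ g.symm : X' → X')) hconj hf ?_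
    rintro _ ⟨n, rfl⟩
    refine ⟨n, funext fun x => ?_⟩
    simp only [Function.comp, hz, Homeomorph.apply_symm_apply]
  refine ⟨fun f => ⟨_, hmem f.1 f.2⟩, ⟨fun f k => ?_, ?_, fun n f => ?_⟩,
    (hconj.comp continuous_subtype_val).subtype_mk _⟩
  · refine Subtype.ext (funext fun x => ?_)
    change g (f.1 (k.1 (g.symm x))) = g (f.1 (g.symm (g (k.1 (g.symm x)))))
    rw [Homeomorph.symm_apply_apply]
  · exact Subtype.ext (funext fun x => g.apply_symm_apply x)
  · exact Subtype.ext (funext fun x => hz n _)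

end Continuity

/-! ### Substitution shifts coded by digit cocycles -/

section Words

variable {A : Type}

/-- A coding of the letters by a parity and a sign, for which the substitution is the one
of the digit cocycle attached to `ψ`. -/
structure IsDigitCoding (ψ : ZMod 2 → ZMod 2) (θ : A → List A) (L : ZMod 2 → ZMod 2 → A)
    (sg : A → ZMod 2) : Prop where
  sign_letter : ∀ t s, sg (L t s) = s
  exists_letter : ∀ a, ∃ t s, a = L t s
  subst : ∀ t s, θ (L t s) = [L 0 s, L 1 (s + ψ t)]

variable {ψ : ZMod 2 → ZMod 2} {e β : ℤ_[2] → ZMod 2} {θ : A → List A} {L : ZMod 2 → ZMod 2 → A}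
  {sg : A → ZMod 2}

/-- Climbing from 0 through positive integers never uses the increment at 0, so the constant of
`IsDigitCocycle.even_apply` is 0 here. -/
theorem IsDigitCocycle.natCast_two_mul (hβ : IsDigitCocycle ψ e β) (p : ℕ) :
    β (2 * (p : ℤ_[2])) = β p := by
  induction p with
  | zero => simp
  | succ p ih =>
    have h0 : ((p + 1 : ℕ) : ℤ_[2]) ≠ 0 := by exact_mod_cast p.succ_ne_zero
    rw [hβ.even_step h0, hβ.step ((p + 1 : ℕ) : ℤ_[2])]
    push_cast
    rw [add_sub_cancel_right, ih]

/-- The letter at the natural address `p`. -/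
noncomputable def digitLetter (L : ZMod 2 → ZMod 2 → A) (β : ℤ_[2] → ZMod 2) (c : ZMod 2) (p : ℕ) : A :=
  L p (β p + c)

theorem IsDigitCoding.subst_digitLetter (hL : IsDigitCoding ψ θ L sg) (hβ : IsDigitCocycle ψ e β)
    (c : ZMod 2) (p : ℕ) :
    θ (digitLetter L β c p) = [digitLetter L β c (2 * p), digitLetter L β c (2 * p + 1)] := by
  have h1 := hβ.natCast_two_mul p
  have h2 := hβ.odd_apply (p : ℤ_[2])
  rw [h1] at h2
  have hb : bit (p : ℤ_[2]) = p := by simp [bit]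
  have h3 : ((2 * p : ℕ) : ZMod 2) = 0 := by
    push_cast; rw [two_mul]; exact zmod_two_add_self _
  have h4 : ((2 * p + 1 : ℕ) : ZMod 2) = 1 := by
    rw [Nat.cast_succ, h3, zero_add]
  rw [hb] at h2
  rw [digitLetter, digitLetter, digitLetter, hL.subst, h3, h4]
  push_cast
  rw [h1, h2, add_right_comm]

theorem IsDigitCoding.substWord_range (hL : IsDigitCoding ψ θ L sg) (hβ : IsDigitCocycle ψ e β)
    (c : ZMod 2) (q n : ℕ) :
    substWord θ ((List.range n).map fun m => digitLetter L β c (q + m)) =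
      (List.range (2 * n)).map fun m => digitLetter L β c (2 * q + m) := by
  induction n with
  | zero => rfl
  | succ n ih =>
    rw [List.range_succ, List.map_append, substWord, List.flatMap_append, ← substWord, ih,
      show 2 * (n + 1) = 2 * n + 1 + 1 by ring, List.range_succ, List.range_succ]
    simp only [List.map_append, List.map_cons, List.map_nil, List.flatMap_cons, List.flatMap_nil,
      List.append_nil, List.append_assoc]
    rw [hL.subst_digitLetter hβ, show 2 * (q + n) = 2 * q + 2 * n by ring]
    rfl

theorem IsDigitCoding.iterate_substWord (hL : IsDigitCoding ψ θ L sg) (hβ : IsDigitCocycle ψ e β)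
    (c : ZMod 2) (p k : ℕ) : (substWord θ)^[k] [digitLetter L β c p] =
      (List.range (2 ^ k)).map fun m => digitLetter L β c (2 ^ k * p + m) := by
  induction k with
  | zero => simp
  | succ k ih =>
    rw [Function.iterate_succ_apply', ih, hL.substWord_range hβ, pow_succ']
    simp only [mul_assoc]

theorem infix_map_range {f : ℕ → A} {N : ℕ} {w : List A} (h : w <:+: (List.range N).map f) :
    ∃ i, w = (List.range w.length).map fun j => f (i + j) := by
  obtain ⟨s, t, hst⟩ := h
  refine ⟨s.length, List.ext_getElem (by simp) fun j h1 h2 => ?_⟩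
  have hlen := congrArg List.length hst
  simp only [List.length_append, List.length_map, List.length_range] at hlen
  have h3 : ((List.range N).map f)[s.length + j]'(by simp; omega) = f (s.length + j) := by simp
  rw [List.getElem_map, List.getElem_range, ← h3]
  simp only [← hst]
  rw [List.getElem_append_left (by simp; omega), List.getElem_append_right (by omega)]
  congr 1
  omega

theorem map_range_infix {f : ℕ → A} {p n N : ℕ} (h : p + n ≤ N) :
    ((List.range n).map fun j => f (p + j)) <:+: (List.range N).map f := by
  obtain ⟨m, rfl⟩ := Nat.exists_eq_add_of_le h
  refine ⟨(List.range p).map f, (List.range m).map fun j => f (p + n + j), ?_⟩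
  rw [List.range_add, List.range_add]
  simp [Function.comp_def]

/-- The allowed words are the words read along natural addresses. -/
theorem IsDigitCoding.isAllowedWord_iff (hL : IsDigitCoding ψ θ L sg) (hβ : IsDigitCocycle ψ e β)
    (w : List A) : IsAllowedWord θ w ↔
      ∃ (p : ℕ) (c : ZMod 2), w = (List.range w.length).map fun j => digitLetter L β c (p + j) := by
  constructor
  · rintro ⟨a, k, h⟩
    obtain ⟨t, s, rfl⟩ := hL.exists_letter a
    have : L t s = digitLetter L β (s - β (t.val : ℕ)) t.val := by
      rw [digitLetter, ZMod.natCast_zmod_val, add_sub_cancel]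
    rw [this, hL.iterate_substWord hβ] at h
    obtain ⟨i, hi⟩ := infix_map_range h
    exact ⟨2 ^ k * t.val + i, _, by simpa only [add_assoc] using hi⟩
  · rintro ⟨p, c, hw⟩
    refine ⟨digitLetter L β c 0, p + w.length, ?_⟩
    rw [hL.iterate_substWord hβ, hw]
    simp only [mul_zero, zero_add, List.length_map, List.length_range]
    exact map_range_infix Nat.lt_two_pow_self.le

end Words

/-! ### Addresses of bi-infinite sequences; substitution shifts as models. -/

section Coding

variable {A : Type} {ψ : ZMod 2 → ZMod 2} {e β : ℤ_[2] → ZMod 2} {θ : A → List A}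
  {L : ZMod 2 → ZMod 2 → A} {sg : A → ZMod 2}

/-- The address of the origin is determined by the signs. -/
theorem IsDigitCocycle.address_unique (hβ : IsDigitCocycle ψ e β) {s : ℤ → ZMod 2} {y y' : ℤ_[2]}
    (hy : ∀ n : ℤ, y + n ≠ 0 → s n = s (n - 1) + e (y + n))
    (hy' : ∀ n : ℤ, y' + n ≠ 0 → s n = s (n - 1) + e (y' + n)) : y = y' := by
  by_contra hne
  have hconst : ∀ {y : ℤ_[2]}, (∀ n : ℤ, y + n ≠ 0 → s n = s (n - 1) + e (y + n)) →
      ∃ c, ∀ᶠ n : ℤ in dir true, s n - β (y + n) = c := by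
    intro y hy
    refine dir_const ?_
    filter_upwards [dir_add_ne_zero true y] with n hn
    have h1 := hy n hn
    have h2 := hβ.step (y + n)
    rw [show y + ((n - 1 : ℤ) : ℤ_[2]) = y + n - 1 by push_cast; ring]
    linear_combination h1 - h2
  obtain ⟨c, hc⟩ := hconst hy
  obtain ⟨c', hc'⟩ := hconst hy'
  have hsum : ∀ᶠ n : ℤ in dir true, β (y + n) + β (y' + n) = c + c' := by
    filter_upwards [hc, hc'] with n h1 h2
    linear_combination -h1 - h2 + zmod_two_add_self (s n) - zmod_two_add_self c -
      zmod_two_add_self c'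
  -- Both cocycles follow the same signs towards +∞ up to constants, so their sum is eventually
  -- constant; independence forbids this for distinct addresses.
  refine hβ.not_evPer true _ (Finset.univ : Finset Bool) (fun b => cond b y y') rfl
    Finset.univ_nonempty (fun a _ b _ hab => ?_) 0 ?_
  · cases a <;> cases b <;> simp_all
  · simp only [Fintype.sum_bool, cond_true, cond_false]
    filter_upwards [hsum, (dir_tendsto_add true (2 ^ (0 + 2))).eventually hsum] with n h1 h2
    rw [h1, h2]

/-- The sequence `x` has address `y` at the origin. -/
structure HasAddress (e : ℤ_[2] → ZMod 2) (L : ZMod 2 → ZMod 2 → A) (sg : A → ZMod 2)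
    (x : ℤ → A) (y : ℤ_[2]) : Prop where
  letter : ∀ n : ℤ, x n = L (bit (y + n)) (sg (x n))
  step : ∀ n : ℤ, y + n ≠ 0 → sg (x n) = sg (x (n - 1)) + e (y + n)

/-- Parity is locally constant and so is the increment away from 0. The only condition lost in the
limit is the one at the place of address 0. -/
theorem HasAddress.of_tendsto (hβ : IsDigitCocycle ψ e β) {α : Type*} {l : Filter α} [l.NeBot]
    {Y : α → ℤ_[2]} {y : ℤ_[2]} (hY : Tendsto Y l (𝓝 y)) {x : ℤ → A}
    (h : ∀ n : ℤ, ∀ᶠ a in l, x n = L (bit (Y a + n)) (sg (x n)) ∧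
      (Y a + n ≠ 0 → sg (x n) = sg (x (n - 1)) + e (Y a + n))) : HasAddress e L sg x y := by
  have hYn : ∀ n : ℤ, Tendsto (fun a => Y a + n) l (𝓝 (y + n)) := fun n => hY.add_const _
  refine ⟨fun n => ?_, fun n hn => ?_⟩
  · obtain ⟨a, ⟨h1, _⟩, h2⟩ := ((h n).and ((hYn n).eventually (eventually_bit_eq _))).exists
    rw [← h2]; exact h1
  · obtain ⟨a, ⟨_, h1⟩, h2, h3⟩ := ((h n).and (((hYn n).eventually (hβ.locally_constant hn)).and
      ((hYn n).eventually (isOpen_ne.mem_nhds hn)))).exists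
    rw [← h2]; exact h1 h3

theorem HasAddress.shift {x : ℤ → A} {y : ℤ_[2]} (h : HasAddress e L sg x y) :
    HasAddress e L sg (fun n => x (n + 1)) (y + 1) := by
  have h1 : ∀ n : ℤ, y + 1 + n = y + ((n + 1 : ℤ) : ℤ_[2]) := fun n => by push_cast; ring
  refine ⟨fun n => ?_, fun n hn => ?_⟩
  · rw [h1]; exact h.letter (n + 1)
  · rw [h1] at hn ⊢
    have := h.step (n + 1) hn
    rwa [add_sub_right_comm] at this

theorem ofFn_eq_map_range {n : ℕ} (f : ℕ → A) :
    (List.ofFn fun j : Fin n => f j) = (List.range n).map f :=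
  List.ext_getElem (by simp) fun j h1 h2 => by simp

/-- The window from -N to N is read along natural addresses from some p N on, so the origin has
provisional address p N + N. A limit point in ℤ₂ of these is an address. -/
theorem IsDigitCoding.exists_hasAddress (hL : IsDigitCoding ψ θ L sg)
    (hβ : IsDigitCocycle ψ e β) {x : ℤ → A} (hx : x ∈ substShiftSet θ) :
    ∃ y, HasAddress e L sg x y := by
  have hw : ∀ N : ℕ, ∃ (p : ℕ) (c : ZMod 2), ∀ n : ℤ, -N ≤ n → n ≤ N →
      x n = digitLetter L β c (p + (n + N).toNat) := by
    intro N
    obtain ⟨p, c, hpc⟩ := (hL.isAllowedWord_iff hβ _).1 (hx (-N) (2 * N + 1))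
    refine ⟨p, c, fun n h1 h2 => ?_⟩
    have h3 : (n + N).toNat < 2 * N + 1 := by omega
    have h4 := congrArg (fun l : List A => l[(n + N).toNat]?) hpc
    simp only [List.length_ofFn, List.getElem?_ofFn, List.getElem?_map, List.getElem?_range,
      h3, dif_pos, Option.map_some, Option.some_inj] at h4
    rw [← h4]
    congr 1
    omega
  choose p c hpc using hw
  let Y : ℕ → ℤ_[2] := fun N => p N + N
  have hlim := Ultrafilter.le_nhds_lim ((hyperfilter ℕ).map Y)
  refine ⟨_, HasAddress.of_tendsto hβ (l := (hyperfilter ℕ : Filter ℕ)) (Y := Y) hlim fun n => ?_⟩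
  have hN : ∀ᶠ N : ℕ in (hyperfilter ℕ : Filter ℕ), n.natAbs + 1 ≤ N :=
    Nat.hyperfilter_le_atTop (eventually_ge_atTop _)
  filter_upwards [hN] with N hN
  have haddr : ∀ m : ℤ, -N ≤ m → m ≤ N → ((p N + (m + N).toNat : ℕ) : ℤ_[2]) = Y N + m := by
    intro m h1 h2
    have h3 : ((p N + (m + N).toNat : ℕ) : ℤ) = p N + N + m := by push_cast; omega
    have := congrArg (fun k : ℤ => (k : ℤ_[2])) h3
    simp only [Int.cast_natCast, Int.cast_add] at this
    exact this
  have hlet : ∀ m : ℤ, -N ≤ m → m ≤ N → x m = L (bit (Y N + m)) (β (Y N + m) + c N) := by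
    intro m h1 h2
    rw [← haddr m h1 h2, hpc N m h1 h2, digitLetter]
    congr 1
    simp [bit]
  have h1 := hlet n (by omega) (by omega)
  have h2 := hlet (n - 1) (by omega) (by omega)
  refine ⟨?_, fun _ => ?_⟩
  · rw [h1, hL.sign_letter]
  · rw [h1, h2, hL.sign_letter, hL.sign_letter, hβ.step]
    rw [show Y N + ((n - 1 : ℤ) : ℤ_[2]) = Y N + n - 1 by push_cast; ring]; ring

/-- A finite window must be found along natural addresses. Numbers close to its starting address `z`
reproduce all increments except the free one at 0. -/
theorem IsDigitCoding.mem_substShiftSet (hL : IsDigitCoding ψ θ L sg)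
    (hβ : IsDigitCocycle ψ e β) {y : ℤ_[2]} {s : ℤ → ZMod 2}
    (hs : ∀ n : ℤ, y + n ≠ 0 → s n = s (n - 1) + e (y + n)) :
    (fun n : ℤ => L (bit (y + n)) (s n)) ∈ substShiftSet θ := by
  intro i n
  set z := y + i with hz
  obtain ⟨b, hb⟩ : ∃ b, ∀ j : ℕ, z + j = 0 → s (i + j) = s (i + j - 1) + b := by
    by_cases h : ∃ j : ℕ, z + j = 0
    · obtain ⟨j, hj⟩ := h
      refine ⟨s (i + j) - s (i + j - 1), fun k hk => ?_⟩
      have h1 : (k : ℤ_[2]) = j := by linear_combination hk - hj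
      obtain rfl : k = j := by exact_mod_cast h1
      ring
    · exact ⟨0, fun j hj => absurd ⟨j, hj⟩ h⟩
  have hloc : ∀ᶠ m : ℤ in dir true ⊓ padicFilter z, 0 ≤ m ∧ ∀ j ∈ Finset.range n,
      bit (m + j : ℤ_[2]) = bit (z + j) ∧ (z + j ≠ 0 → e (m + j) = e (z + j)) := by
    refine Eventually.and ((dir_eventually_side true).filter_mono inf_le_left)
      (Eventually.filter_mono inf_le_right ((eventually_all_finset _).2 fun j _ => ?_))
    have h1 : Tendsto (fun m : ℤ => (m + j : ℤ_[2])) (padicFilter z) (𝓝 (z + j)) :=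
      (tendsto_padicFilter z).add_const _
    refine (h1.eventually (eventually_bit_eq _)).and ?_
    by_cases h : z + j = 0
    · exact Eventually.of_forall fun m hm => absurd h hm
    · exact (h1.eventually (hβ.locally_constant h)).mono fun m hm _ => hm
  -- If z + j = 0 then m + j = m - z, so choosing the increment at m - z to be `b` reproduces the
  -- jump across the gap as well.
  obtain ⟨m, hm, hm0, hmj⟩ := ((hβ.frequently_eq true z b).and_eventually hloc).exists
  obtain ⟨p, rfl⟩ := Int.eq_ofNat_of_zero_le hm0
  rw [Int.cast_natCast] at hm
  simp only [Int.cast_natCast, Finset.mem_range] at hmj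
  have hval : ∀ j < n, s (i + j) = β ((p + j : ℕ) : ℤ_[2]) + (s i - β p) := by
    intro j
    induction j with
    | zero => intro _; simp
    | succ j ih =>
      intro hj
      have h1 := ih (by omega)
      have h2 := hβ.step ((p + (j + 1) : ℕ) : ℤ_[2])
      rw [show ((p + (j + 1) : ℕ) : ℤ_[2]) - 1 = ((p + j : ℕ) : ℤ_[2]) by push_cast; ring] at h2
      have h3 : s (i + (j + 1 : ℕ)) = s (i + j) + e ((p + (j + 1) : ℕ) : ℤ_[2]) := by
        have hij : i + ((j + 1 : ℕ) : ℤ) - 1 = i + j := by push_cast; ring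
        by_cases h0 : z + ((j + 1 : ℕ) : ℤ_[2]) = 0
        · rw [hb _ h0, hij, ← hm]
          congr 2
          push_cast at h0 ⊢
          linear_combination -h0
        · have h4 := hs (i + (j + 1 : ℕ)) (by
            intro h5; apply h0; rw [← h5, hz]; push_cast; ring)
          rw [hij] at h4
          rw [h4]
          congr 1
          have h5 := (hmj (j + 1) hj).2 h0
          push_cast at h5 ⊢
          rw [h5, hz]
          congr 1; ring
      rw [h3, h2, h1]; ring
  refine (hL.isAllowedWord_iff hβ _).2 ⟨p, s i - β p, ?_⟩
  rw [List.length_ofFn]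
  have := ofFn_eq_map_range (n := n) fun j : ℕ => L (bit (y + ((i + j : ℤ) : ℤ_[2]))) (s (i + j))
  refine this.trans (List.map_congr_left fun j hj => ?_)
  rw [List.mem_range] at hj
  rw [digitLetter, hval j hj]
  have h1 := (hmj j hj).1
  have h2 : bit (p + j : ℤ_[2]) = ((p + j : ℕ) : ZMod 2) := by simp [bit]
  rw [show y + ((i + j : ℤ) : ℤ_[2]) = z + j by rw [hz]; push_cast; ring, ← h1, h2]

variable [TopologicalSpace A]

theorem substShiftMap_zpow_apply (n : ℤ) (x : SubstShift θ) (m : ℤ) :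
    ((substShiftMap θ ^ n) x).1 m = x.1 (m + n) := by
  have h1 : ∀ (x : SubstShift θ) (m : ℤ), (substShiftMap θ x).1 m = x.1 (m + 1) := fun _ _ => rfl
  induction n using Int.induction_on generalizing x m with
  | zero => simp
  | succ n ih =>
    rw [zpow_add_apply', ih, zpow_one, h1, add_assoc]
  | pred n ih =>
    rw [sub_eq_add_neg, zpow_add_apply', ih, zpow_neg_one]
    change x.1 _ = _
    rw [add_assoc]

theorem compactSpace_substShift [DiscreteTopology A] [Finite A] (θ : A → List A) :
    CompactSpace (SubstShift θ) := by
  rw [← isCompact_iff_compactSpace]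
  refine IsClosed.isCompact ?_
  have : substShiftSet θ = ⋂ (i : ℤ) (n : ℕ), (fun (x : ℤ → A) (j : Fin n) => x (i + (j : ℕ))) ⁻¹'
      {u | IsAllowedWord θ (List.ofFn u)} := by
    ext x; simp [substShiftSet]
  rw [this]
  refine isClosed_iInter fun i => isClosed_iInter fun n => (isClosed_discrete _).preimage ?_
  exact continuous_pi fun j => continuous_apply _

/-- A substitution shift coded by a digit cocycle is a model. -/
theorem IsDigitCoding.exists_isModel [DiscreteTopology A] (hL : IsDigitCoding ψ θ L sg)
    (hβ : IsDigitCocycle ψ e β) :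
    ∃ π : SubstShift θ → ℤ_[2], IsModel e (substShiftMap θ) π (fun x => sg (x.1 0)) ∧
      ∀ x, HasAddress e L sg x.1 (π x) := by
  choose π hπ using fun x : SubstShift θ => hL.exists_hasAddress hβ x.2
  have huniq : ∀ {x : SubstShift θ} {y}, HasAddress e L sg x.1 y → y = π x := fun {x y} hy =>
    hβ.address_unique (s := fun n => sg (x.1 n)) hy.step (hπ x).step
  have hsign : ∀ (x : SubstShift θ) (n : ℤ), sg (((substShiftMap θ ^ n) x).1 0) = sg (x.1 n) := by
    intro x n
    rw [substShiftMap_zpow_apply, zero_add]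
  have hcoord : ∀ n : ℤ, Continuous fun x : SubstShift θ => x.1 n := fun n =>
    (continuous_apply n).comp continuous_subtype_val
  refine ⟨π, ⟨?_, ?_, fun x => (huniq (hπ x).shift).symm, fun x x' h1 h2 => ?_, fun x hx => ?_,
    fun y s hs => ?_⟩, hπ⟩
  -- Closed graph argument: a limit of addresses is an address of the limit point, and addresses are
  -- unique.
  · refine continuous_iff_ultrafilter.2 fun x U hU => ?_
    have hlim := Ultrafilter.le_nhds_lim (U.map π)
    have : HasAddress e L sg x.1 (U.map π).lim := by
      refine HasAddress.of_tendsto hβ (l := (U : Filter (SubstShift θ))) (Y := π) hlim fun n => ?_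
      have h1 : ∀ n : ℤ, ∀ᶠ x' : SubstShift θ in (U : Filter (SubstShift θ)), x'.1 n = x.1 n :=
        fun n => eventually_eq_of_tendsto_discrete (((hcoord n).tendsto x).mono_left hU)
      filter_upwards [h1 n, h1 (n - 1)] with x' h2 h3
      rw [← h2, ← h3]
      exact ⟨(hπ x').letter n, (hπ x').step n⟩
    rw [← huniq this]
    exact hlim
  · exact continuous_of_discreteTopology.comp (hcoord 0)
  · refine Subtype.ext (funext fun n => ?_)
    rw [(hπ x).letter n, (hπ x').letter n, h1]
    have := h2 n
    simp only [hsign] at this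
    rw [this]
  · rw [← huniq (hπ x).shift] at hx ⊢
    have h1 := (hπ x).shift.step 0
    simp only [Int.cast_zero, add_zero] at h1
    change sg (x.1 (0 + 1)) = _
    simpa using h1 hx
  · refine ⟨⟨_, hL.mem_substShiftSet hβ hs⟩, (huniq ⟨fun n => ?_, fun n hn => ?_⟩).symm,
      fun n => ?_⟩
    · simp only [hL.sign_letter]
    · simp only [hL.sign_letter]
      exact hs n hn
    · simp only [hsign, hL.sign_letter]

end Coding

/-! ### Fixed points of the squared substitution. -/

section FixedPoints

variable {A : Type} {ψ : ZMod 2 → ZMod 2} {e β : ℤ_[2] → ZMod 2} {θ : A → List A}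
  {L : ZMod 2 → ZMod 2 → A} {sg : A → ZMod 2}

theorem bit_add_intCast (y : ℤ_[2]) (n : ℤ) : bit (y + n) = bit y + n := by simp [bit]

theorem intCast_four_mul (m : ℤ) : ((4 * m : ℤ) : ZMod 2) = 0 := by
  rw [show (4 * m : ℤ) = 2 * m + 2 * m by ring, Int.cast_add]
  exact zmod_two_add_self _

/-- The sign sequence of the image under the square of the substitution. -/
theorem IsIncrement.square_step (he : IsIncrement ψ e) {y : ℤ_[2]} {s s' : ℤ → ZMod 2}
    (hs : ∀ n : ℤ, y + n ≠ 0 → s n = s (n - 1) + e (y + n))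
    (h0 : ∀ m, s' (4 * m) = s m) (h1 : ∀ m, s' (4 * m + 1) = s m + ψ 0)
    (h2 : ∀ m : ℤ, s' (4 * m + 2) = s m + ψ (bit (y + m)))
    (h3 : ∀ m : ℤ, s' (4 * m + 3) = s m + ψ (bit (y + m)) + ψ 1) (n : ℤ) (hn : 4 * y + n ≠ 0) :
    s' n = s' (n - 1) + e (4 * y + n) := by
  obtain ⟨m, hm⟩ : ∃ m, n = 4 * m ∨ n = 4 * m + 1 ∨ n = 4 * m + 2 ∨ n = 4 * m + 3 :=
    ⟨n / 4, by omega⟩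
  rcases hm with rfl | rfl | rfl | rfl
  · have hw : y + m ≠ 0 := fun h => hn (by push_cast; linear_combination 4 * h)
    rw [show 4 * m - 1 = 4 * (m - 1) + 3 by ring, h0, h3, hs m hw,
      show 4 * y + ((4 * m : ℤ) : ℤ_[2]) = 2 * (2 * (y + m)) by push_cast; ring,
      he.even _ (mul_ne_zero two_ne_zero hw), he.even _ hw, bit_two_mul, bit_add_intCast,
      bit_add_intCast, zero_sub, show (-1 : ZMod 2) = 1 from rfl]
    push_cast
    simp only [← add_sub_assoc]
    ring
  · rw [add_sub_cancel_right, h1, h0,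
      show 4 * y + ((4 * m + 1 : ℤ) : ℤ_[2]) = 2 * (2 * (y + m)) + 1 by push_cast; ring,
      he.odd, bit_two_mul]
  · rw [show 4 * m + 2 - 1 = 4 * m + 1 by ring, h1, h2,
      show 4 * y + ((4 * m + 2 : ℤ) : ℤ_[2]) = 2 * (2 * (y + m) + 1) by push_cast; ring,
      he.even _ (odd_ne_zero _), he.odd, bit_two_mul_add_one, sub_self]
    ring
  · rw [show 4 * m + 3 - 1 = 4 * m + 2 by ring, h2, h3,
      show 4 * y + ((4 * m + 3 : ℤ) : ℤ_[2]) = 2 * (2 * (y + m) + 1) + 1 by push_cast; ring,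
      he.odd, bit_two_mul_add_one]

theorem IsDigitCoding.isSubstFixedPoint_iff (hL : IsDigitCoding ψ θ L sg) (x : ℤ → A) :
    IsSubstFixedPoint (substSquare θ) 4 x ↔ ∀ (m : ℤ) (t s : ZMod 2), x m = L t s →
      x (4 * m) = L 0 s ∧ x (4 * m + 1) = L 1 (s + ψ 0) ∧ x (4 * m + 2) = L 0 (s + ψ t) ∧
        x (4 * m + 3) = L 1 (s + ψ t + ψ 1) := by
  have hsq : ∀ t s, substSquare θ (L t s) =
      [L 0 s, L 1 (s + ψ 0), L 0 (s + ψ t), L 1 (s + ψ t + ψ 1)] := by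
    intro t s
    simp [substSquare, substWord, hL.subst]
  have key : ∀ (m : ℤ) (t s : ZMod 2), x m = L t s →
      ((List.ofFn fun j : Fin 4 => x (((4 : ℕ) : ℤ) * m + (j : ℕ))) = substSquare θ (x m) ↔
        (x (4 * m) = L 0 s ∧ x (4 * m + 1) = L 1 (s + ψ 0) ∧ x (4 * m + 2) = L 0 (s + ψ t) ∧
        x (4 * m + 3) = L 1 (s + ψ t + ψ 1))) := by
    intro m t s h
    rw [h, hsq]
    simp [List.ofFn_succ]
  refine ⟨fun h m t s hts => (key m t s hts).1 (h m), fun h m => ?_⟩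
  obtain ⟨t, s, hts⟩ := hL.exists_letter (x m)
  exact (key m t s hts).2 (h m t s hts)

variable [TopologicalSpace A]

/-- The points fixed by the square of the substitution are the points over `0`. -/
theorem IsDigitCoding.fixed_iff (hL : IsDigitCoding ψ θ L sg) (hβ : IsDigitCocycle ψ e β)
    {π : SubstShift θ → ℤ_[2]} (hM : IsModel e (substShiftMap θ) π (fun x => sg (x.1 0)))
    (hπ : ∀ x, HasAddress e L sg x.1 (π x)) (x : SubstShift θ) :
    IsSubstFixedPoint (substSquare θ) 4 x.1 ↔ π x = 0 := by
  rw [hL.isSubstFixedPoint_iff]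
  constructor
  · intro h
    have h' := fun m : ℤ => h m _ _ ((hπ x).letter m)
    have h4 := hβ.square_step (s' := fun n => sg (x.1 n)) (hπ x).step
      (fun m => by simp only [(h' m).1, hL.sign_letter])
      (fun m => by simp only [(h' m).2.1, hL.sign_letter])
      (fun m => by simp only [(h' m).2.2.1, hL.sign_letter])
      (fun m => by simp only [(h' m).2.2.2, hL.sign_letter])
    -- The squared substitution multiplies addresses by 4, so a fixed point has y = 4y.
    have h5 := hβ.address_unique (s := fun n => sg (x.1 n)) (hπ x).step h4
    have h6 : (3 : ℤ_[2]) * π x = 0 := by linear_combination -h5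
    exact (mul_eq_zero.1 h6).resolve_left (by norm_num)
  · intro h0
    let s : ℤ → ZMod 2 := fun n => sg (x.1 n)
    let s' : ℤ → ZMod 2 := fun n => s (n / 4) + if n % 4 = 0 then 0 else if n % 4 = 1 then ψ 0
      else if n % 4 = 2 then ψ (bit (0 + ((n / 4 : ℤ) : ℤ_[2])))
      else ψ (bit (0 + ((n / 4 : ℤ) : ℤ_[2]))) + ψ 1
    have hs : ∀ n : ℤ, (0 : ℤ_[2]) + n ≠ 0 → s n = s (n - 1) + e (0 + n) := h0 ▸ (hπ x).step
    have hdiv : ∀ m r : ℤ, 0 ≤ r → r < 4 → (4 * m + r) / 4 = m ∧ (4 * m + r) % 4 = r := by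
      intro m r h1 h2; omega
    have e0 : ∀ m, s' (4 * m) = s m := fun m => by
      have := hdiv m 0 (by norm_num) (by norm_num)
      rw [add_zero] at this
      simp [s', this.1]
    have e1 : ∀ m, s' (4 * m + 1) = s m + ψ 0 := fun m => by
      have := hdiv m 1 (by norm_num) (by norm_num)
      simp [s', this.1, this.2]
    have e2 : ∀ m : ℤ, s' (4 * m + 2) = s m + ψ (bit (0 + m)) := fun m => by
      have := hdiv m 2 (by norm_num) (by norm_num)
      simp [s', this.1, this.2]
    have e3 : ∀ m : ℤ, s' (4 * m + 3) = s m + ψ (bit (0 + m)) + ψ 1 := fun m => by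
      have := hdiv m 3 (by norm_num) (by norm_num)
      simp [s', this.1, this.2, add_assoc]
    have hs' := hβ.square_step hs e0 e1 e2 e3
    rw [mul_zero] at hs'
    obtain ⟨x', hx', hxs⟩ := hM.exists_point 0 s' hs'
    have hsign : ∀ (x : SubstShift θ) (n : ℤ), sg (((substShiftMap θ ^ n) x).1 0) = sg (x.1 n) := by
      intro x n
      rw [substShiftMap_zpow_apply, zero_add]
    simp only [hsign] at hxs
    have hxx : x = x' := by
      refine hM.ext_zero hβ h0 hx' ?_ ?_
      · have := e0 0
        rw [mul_zero, ← hxs] at this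
        exact this.symm
      -- At place -1 each application of the substitution adds ψ 1 = 1 to the sign. Only the square
      -- restores it.
      · have h3 := e3 (-1)
        have hb : bit (0 + ((-1 : ℤ) : ℤ_[2])) = 1 := by
          rw [bit_add_intCast]; simp [bit]
        rw [hb, add_assoc, zmod_two_add_self, add_zero, show (4 * -1 + 3 : ℤ) = -1 by norm_num,
          ← hxs] at h3
        simp only [hsign]
        exact h3.symm
    have hss : ∀ n, sg (x.1 n) = s' n := fun n => by rw [← hxs n, ← hxx]
    have hlet : ∀ n : ℤ, x.1 n = L n (sg (x.1 n)) := by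
      intro n
      have := (hπ x).letter n
      rwa [h0, zero_add, bit_intCast] at this
    intro m t r htr
    have hsm : s m = r := by simp only [s]; rw [htr, hL.sign_letter]
    -- A letter need not determine its parity label, as for Thue–Morse, but its image under the
    -- substitution determines ψ of that label.
    have htr' : ψ t = ψ (bit (0 + (m : ℤ_[2]))) := by
      have h1 := htr.symm.trans (hlet m)
      rw [show sg (x.1 m) = r from hsm] at h1
      have h2 := (hL.subst t r).symm.trans ((congrArg θ h1).trans (hL.subst m r))
      simp only [List.cons.injEq, and_true, true_and] at h2
      have h3 := congrArg sg h2
      rw [hL.sign_letter, hL.sign_letter] at h3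
      rw [zero_add, bit_intCast]
      exact add_left_cancel h3
    refine ⟨?_, ?_, ?_, ?_⟩
    · rw [hlet, hss, e0, hsm, intCast_four_mul]
    · rw [hlet, hss, e1, hsm, Int.cast_add, intCast_four_mul]; simp
    · rw [hlet, hss, e2, hsm, Int.cast_add, intCast_four_mul, htr']; rfl
    · rw [hlet, hss, e3, hsm, Int.cast_add, intCast_four_mul, htr']; rfl

end FixedPoints

/-! ### Thue–Morse and Rudin–Shapiro as digit codings. -/

section Examples

theorem isDigitCoding_thueMorse : IsDigitCoding (fun _ => 1) thueMorse
    (fun _ s => if s = 0 then 0 else 1) (fun a => if a = 0 then 0 else 1) where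
  sign_letter := by decide
  exists_letter := by decide
  subst := by decide

/-- The letters a, d occupy even addresses and c, b odd ones; a, c carry sign 0 and d, b sign 1. -/
theorem isDigitCoding_rudinShapiro : IsDigitCoding id rudinShapiro
    (fun t s => if t = 0 then (if s = 0 then 0 else 3) else (if s = 0 then 2 else 1))
    ![0, 1, 0, 1] where
  sign_letter := by decide
  exists_letter := by decide
  subst := by decide

variable {A : Type} [TopologicalSpace A] [DiscreteTopology A] [Finite A]
  {ψ : ZMod 2 → ZMod 2} {e β : ℤ_[2] → ZMod 2} {θ : A → List A}
  {L : ZMod 2 → ZMod 2 → A} {sg : A → ZMod 2}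

/-- The singular fibres of a substitution shift coded by a digit cocycle. -/
theorem IsDigitCoding.singular_fibres (hL : IsDigitCoding ψ θ L sg) (hβ : IsDigitCocycle ψ e β)
    {Y : Type} [UniformSpace Y] [CompactSpace Y] [T2Space Y] {δ : Y ≃ₜ Y} {ρ : SubstShift θ → Y}
    (hρ : IsMaximalEquicontinuousFactor (substShiftMap θ) δ ρ) :
    (∃ ξ : Y, IsSingularPoint (substShiftMap θ) ρ ξ ∧
      ρ ⁻¹' {ξ} = {x | IsSubstFixedPoint (substSquare θ) 4 x.1}) ∧
    ∀ ξ : Y, IsSingularPoint (substShiftMap θ) ρ ξ →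
      Nonempty (kernelFibreSemigroup (substShiftMap θ) ρ ξ ≃* MatrixSemigroupM2) := by
  have := compactSpace_substShift θ
  obtain ⟨π, hM, hπ⟩ := hL.exists_isModel hβ
  -- Uniqueness of the maximal equicontinuous factor moves every question about fibres to the
  -- odometer.
  obtain ⟨g, -, hg⟩ := hρ.exists_homeomorph (hM.isMaximalEquicontinuousFactor hβ)
  have hfib : ∀ x ξ, ρ x = ξ ↔ π x = g ξ := fun x ξ => by
    rw [hg, g.injective.eq_iff]
  have hsing : ∀ ξ, IsSingularPoint (substShiftMap θ) ρ ξ ↔ ∃ n : ℤ, g ξ = n := by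
    intro ξ
    rw [← hM.isSingularPoint_iff hβ]
    simp only [IsSingularPoint, hfib]
  refine ⟨⟨g.symm 0, (hsing _).2 ⟨0, by simp⟩, ?_⟩, fun ξ hξ => ?_⟩
  · ext x
    rw [Set.mem_preimage, Set.mem_singleton_iff, hfib, g.apply_symm_apply, Set.mem_ofPred_eq,
      hL.fixed_iff hβ hM hπ]
  · obtain ⟨n, hn⟩ := (hsing ξ).1 hξ
    refine hM.nonempty_mulEquiv hβ (fun x x' => ?_) (n := n) fun x => ?_
    · rw [hg x, hg x', g.injective.eq_iff]
    · rw [hfib, hn]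

end Examples

end DigitCocycleExtensions

theorem mainTheorem10 :
    -- the matrix semigroup has eight elements
    Nat.card MatrixSemigroupM2 = 8 ∧
    -- Thue–Morse: singular fibres and the restricted kernel semigroup
    (∀ (Y : Type) [UniformSpace Y] [CompactSpace Y] [T2Space Y] (δ : Y ≃ₜ Y)
        (π : SubstShift thueMorse → Y),
      IsMaximalEquicontinuousFactor (substShiftMap thueMorse) δ π →
        (∃ ξ : Y, IsSingularPoint (substShiftMap thueMorse) π ξ ∧
          π ⁻¹' {ξ} = {x | IsSubstFixedPoint (substSquare thueMorse) 4 x.1}) ∧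
        ∀ ξ : Y, IsSingularPoint (substShiftMap thueMorse) π ξ →
          Nonempty (kernelFibreSemigroup (substShiftMap thueMorse) π ξ ≃* MatrixSemigroupM2)) ∧
    -- Rudin–Shapiro: singular fibres and the restricted kernel semigroup
    (∀ (Y : Type) [UniformSpace Y] [CompactSpace Y] [T2Space Y] (δ : Y ≃ₜ Y)
        (π : SubstShift rudinShapiro → Y),
      IsMaximalEquicontinuousFactor (substShiftMap rudinShapiro) δ π →
        (∃ ξ : Y, IsSingularPoint (substShiftMap rudinShapiro) π ξ ∧
          π ⁻¹' {ξ} = {x | IsSubstFixedPoint (substSquare rudinShapiro) 4 x.1}) ∧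
        ∀ ξ : Y, IsSingularPoint (substShiftMap rudinShapiro) π ξ →
          Nonempty (kernelFibreSemigroup (substShiftMap rudinShapiro) π ξ ≃*
            MatrixSemigroupM2)) ∧
    -- both shifts have a maximal equicontinuous factor, and these are conjugate
    (∃ (Y : Type) (_ : UniformSpace Y) (_ : CompactSpace Y) (_ : T2Space Y) (δ : Y ≃ₜ Y)
        (π : SubstShift thueMorse → Y),
      IsMaximalEquicontinuousFactor (substShiftMap thueMorse) δ π) ∧
    (∃ (Y : Type) (_ : UniformSpace Y) (_ : CompactSpace Y) (_ : T2Space Y) (δ : Y ≃ₜ Y)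
        (π : SubstShift rudinShapiro → Y),
      IsMaximalEquicontinuousFactor (substShiftMap rudinShapiro) δ π) ∧
    (∀ (Y : Type) [UniformSpace Y] [CompactSpace Y] [T2Space Y] (δ : Y ≃ₜ Y)
        (π : SubstShift thueMorse → Y)
        (Y' : Type) [UniformSpace Y'] [CompactSpace Y'] [T2Space Y'] (δ' : Y' ≃ₜ Y')
        (π' : SubstShift rudinShapiro → Y'),
      IsMaximalEquicontinuousFactor (substShiftMap thueMorse) δ π →
      IsMaximalEquicontinuousFactor (substShiftMap rudinShapiro) δ' π' →
        AreConjugate δ δ') ∧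
    -- the Ellis semigroups are algebraically isomorphic
    (∃ Φ : EllisSemigroup (substShiftMap thueMorse) → EllisSemigroup (substShiftMap rudinShapiro),
      IsAlgebraicMorphism Φ ∧ Function.Bijective Φ) ∧
    -- the shifts are not conjugate
    ¬ AreConjugate (substShiftMap thueMorse) (substShiftMap rudinShapiro) ∧
    -- no algebraic isomorphism of the Ellis semigroups is continuous
    (∀ Φ : EllisSemigroup (substShiftMap thueMorse) → EllisSemigroup (substShiftMap rudinShapiro),
      IsAlgebraicMorphism Φ → Function.Bijective Φ → ¬ Continuous Φ) := by
  obtain ⟨e, β, hβ⟩ := exists_isDigitCocycle (ψ := fun _ : ZMod 2 => 1) rfl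
  obtain ⟨e', β', hβ'⟩ := exists_isDigitCocycle (ψ := (id : ZMod 2 → ZMod 2)) rfl
  have := compactSpace_substShift thueMorse
  have := compactSpace_substShift rudinShapiro
  obtain ⟨π, hM, -⟩ := isDigitCoding_thueMorse.exists_isModel hβ
  obtain ⟨π', hM', -⟩ := isDigitCoding_rudinShapiro.exists_isModel hβ'
  have hmax := hM.isMaximalEquicontinuousFactor hβ
  have hmax' := hM'.isMaximalEquicontinuousFactor hβ'
  refine ⟨card_matrixSemigroupM2, fun Y _ _ _ δ ρ hρ => isDigitCoding_thueMorse.singular_fibres hβ hρ,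
    fun Y _ _ _ δ ρ hρ => isDigitCoding_rudinShapiro.singular_fibres hβ' hρ,
    ⟨ℤ_[2], inferInstance, inferInstance, inferInstance, odometer, π, hmax⟩,
    ⟨ℤ_[2], inferInstance, inferInstance, inferInstance, odometer, π', hmax'⟩,
    fun Y _ _ _ δ ρ Y' _ _ _ δ' ρ' hρ hρ' => ?_,
    hM.exists_bijective_algebraicMorphism hM' hβ hβ', fun hc => ?_,
    fun Φ hΦ _ => hM.not_continuous hM' hβ hβ' rfl rfl hΦ⟩
  -- Both factors are conjugate to the 2-adic odometer.
  · obtain ⟨g, hg, -⟩ := hρ.exists_homeomorph hmax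
    obtain ⟨g', hg', -⟩ := hmax'.exists_homeomorph hρ'
    exact ⟨g.trans g', fun y => (congrArg g' (hg y)).trans (hg' _)⟩
  · obtain ⟨Φ, hΦ, hΦc⟩ := hc.exists_continuous
    exact hM.not_continuous hM' hβ hβ' rfl rfl hΦ hΦc
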